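/- Let $0<q<1$ and $0<\xi<1$. For a partition $\lambda=(\lambda_1\ge\lambda_2\ge\cdots)$ put $|\lambda|=\sum_i\lambda_i$, $b(\lambda)=\sum_{i\ge1}(i-1)\lambda_i$, and for a cell $(i,j)\in\lambda$ let $h(i,j)=\lambda_i+\lambda^{\mathrm T}_j-i-j+1$ be its hook length, where $\lambda^{\mathrm T}$ is the transposed partition. The squared type $q$-Plancherel measure is the measure on the set of all partitions with weights $$\mu[\lambda]=M(\xi;q)^{-1}(\xi^2q)^{|\lambda|}q^{2b(\lambda)}\prod_{(i,j)\in\lambda}\frac{1}{(1-q^{h(i,j)})^2},\qquad M(\xi;q)=\prod_{n\ge1}\frac{1}{(1-\xi^2q^n)^n}.$$ It is a probability measure, and the random point configuration $\Xi(\lambda)=\{\lambda_i-i+\tfrac12 : i\ge1\}\subset\mathbb Z+\tfrac12$ is a determinantal point process: for every $k\ge0$ and all distinct $z_1,\dots,z_k\in\mathbb Z+\tfrac12$, $$\mu\bigl[\{\lambda : \{z_1,\dots,z_k\}\subset\Xi(\lambda)\}\bigr]=\det_{1\le i,j\le k}K(z_i,z_j).$$ Here $K$ is the $q$-Bessel kernel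 $$K(r,s)=\xi\,\frac{J_{r+\frac12}J_{s-\frac12}-J_{r-\frac12}J_{s+\frac12}}{q^{\frac12(r-s)}-q^{-\frac12(r-s)}},\qquad r\ne s,$$ and on the diagonal $K(r,r)=\lim_{s\to r}K(r,s)$, where $s\ne r$ runs through real numbers and the limit exists. For real $\nu$, $J_\nu=J^{(3)}_\nu(2\xi;q)$ is the Hahn--Exton $q$-Bessel function $$J^{(3)}_\nu(x;q)=\frac{(q^{\nu+1};q)_\infty}{(q;q)_\infty}\Bigl(\frac x2\Bigr)^{\nu}\sum_{m\ge0}\frac{(-1)^mq^{\binom m2}}{(q;q)_m(q^{\nu+1};q)_m}\Bigl(\frac{qx^2}{4}\Bigr)^m,$$ where $(a;q)_m=\prod_{k=0}^{m-1}(1-aq^k)$ and $(a;q)_\infty=\prod_{k\ge0}(1-aq^k)$, and where at negative integers $\nu$ the formula is extended by continuity, i.e. $(q^{\nu+1};q)_\infty/(q^{\nu+1};q)_m$ is read as $(q^{\nu+1+m};q)_\infty$. -/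

import Mathlib

open Filter Topology MeasureTheory

noncomputable section

namespace QPlancherel

/-! ### `q`-functions -/

/-- The finite `q`-shifted factorial `(x; q)_n = ∏_{k < n} (1 - x q^k)`. -/
def qPoch (x q : ℝ) (n : ℕ) : ℝ := ∏ k ∈ Finset.range n, (1 - x * q ^ k)

/-- The infinite `q`-shifted factorial `(x; q)_∞ = ∏_{k ≥ 0} (1 - x q^k)`. -/
def qPochInf (x q : ℝ) : ℝ := ∏' k : ℕ, (1 - x * q ^ k)

/-- The modified MacMahon function `M(ξ; q) = ∏_{n ≥ 1} (1 - ξ² q^n)^{-n}`. -/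
def macMahon (ξ q : ℝ) : ℝ := ∏' n : ℕ, (1 / (1 - ξ ^ 2 * q ^ (n + 1)) ^ (n + 1))

/-- The basic hypergeometric series `₁φ₁(a; b; q, x)`. -/
def phi11 (a b q x : ℝ) : ℝ :=
  ∑' m : ℕ, qPoch a q m / (qPoch q q m * qPoch b q m) *
    ((-1) ^ m * q ^ m.choose 2) * x ^ m

/-- The Hahn–Exton (third Jackson) `q`-Bessel function of real order `ν`,
`J_ν^{(3)}(x; q) = (q^{ν+1}; q)_∞ / (q; q)_∞ (x/2)^ν ₁φ₁(0; q^{ν+1}; q, q x²/4)`.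
The factor `(q^{ν+1}; q)_∞` is multiplied into the series, where
`(q^{ν+1}; q)_∞ / (q^{ν+1}; q)_m = (q^{ν+1+m}; q)_∞`. In this way the negative integers `ν`, at which
the product above reads `0 · ∞`, are covered by continuity, as usual;
see `hahnExton_eq_phi11` for the other `ν`. -/
def hahnExton (ν x q : ℝ) : ℝ :=
  (x / 2) ^ ν * ∑' m : ℕ, qPochInf (q ^ (ν + 1 + m)) q / (qPochInf q q * qPoch q q m) *
    ((-1) ^ m * q ^ m.choose 2) * (q * x ^ 2 / 4) ^ m

/-- Off the negative integers, `hahnExton` is given by the hypergeometric formula. -/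
theorem hahnExton_eq_phi11 (ν x q : ℝ) (hq : 0 < q) (hq1 : q < 1)
    (hν : ∀ k : ℕ, ν ≠ -((k : ℝ) + 1)) :
    hahnExton ν x q = qPochInf (q ^ (ν + 1)) q / qPochInf q q * (x / 2) ^ ν *
      phi11 0 (q ^ (ν + 1)) q (q * x ^ 2 / 4) := by
  have hne : ∀ k : ℕ, 1 - q ^ (ν + 1) * q ^ k ≠ 0 := by
    intro k h
    have h1 : q ^ (ν + 1 + k) = 1 := by
      rw [Real.rpow_add hq, Real.rpow_natCast]; linarith
    have h2 : (ν + 1 + k) * Real.log q = 0 := by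
      rw [← Real.log_rpow hq, h1, Real.log_one]
    rcases mul_eq_zero.1 h2 with h3 | h3
    · exact hν k (by linarith)
    · exact (Real.log_neg hq hq1).ne h3
  have hsplit : ∀ m : ℕ, qPochInf (q ^ (ν + 1)) q =
      qPoch (q ^ (ν + 1)) q m * qPochInf (q ^ (ν + 1 + m)) q := by
    intro m
    have hterm : ∀ k : ℕ, 1 - q ^ (ν + 1) * q ^ (k + m) = 1 - q ^ (ν + 1 + m) * q ^ k := by
      intro k
      rw [Real.rpow_add hq (ν + 1) m, Real.rpow_natCast]; ring
    have hmul : Multipliable fun k : ℕ => 1 - q ^ (ν + 1) * q ^ (k + m) := by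
      simp only [hterm, sub_eq_add_neg]
      refine multipliable_one_add_of_summable ?_
      refine Summable.congr (f := fun k : ℕ => |q ^ (ν + 1 + m)| * q ^ k)
        ((summable_geometric_of_lt_one hq.le hq1).mul_left _) ?_
      intro k
      rw [norm_neg, norm_mul, Real.norm_eq_abs, Real.norm_eq_abs, abs_of_pos (pow_pos hq k)]
    have h := Multipliable.prod_mul_tprod_nat_mul'
      (f := fun k : ℕ => 1 - q ^ (ν + 1) * q ^ k) hmul
    simp only [hterm] at h
    exact h.symm
  unfold hahnExton phi11
  rw [← tsum_mul_left, ← tsum_mul_left]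
  refine tsum_congr fun m => ?_
  have h0 : qPoch 0 q m = 1 := by simp [qPoch]
  have hm : qPoch (q ^ (ν + 1)) q m ≠ 0 := Finset.prod_ne_zero_iff.2 fun k _ => hne k
  rw [h0, hsplit m]
  field_simp

/-! ### Half-integers, partitions and the squared type `q`-Plancherel measure -/

/-- The lattice `ℤ' = ℤ + 1/2`. -/
def halfIntegers : Set ℝ := {x | ∃ n : ℤ, x = n + 1 / 2}

/-- `b(λ) = ∑_{i ≥ 1} (i - 1) λ_i`; row `i` of a Young diagram is counted from `0`. -/
def bStat (lam : YoungDiagram) : ℕ := ∑ i ∈ Finset.range (lam.colLen 0), i * lam.rowLen i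

/-- The hook length `h(i, j) = λ_i + λᵀ_j - i - j + 1` of a cell, in coordinates counted from `0`. -/
def hook (lam : YoungDiagram) (c : ℕ × ℕ) : ℕ := lam.rowLen c.1 + lam.colLen c.2 - c.1 - c.2 - 1

/-- The weight
`M(ξ; q)⁻¹ (ξ² q)^{|λ|} q^{2 b(λ)} ∏_{(i,j) ∈ λ} (1 - q^{h(i,j)})^{-2}` of a partition. -/
def weight (ξ q : ℝ) (lam : YoungDiagram) : ℝ :=
  (macMahon ξ q)⁻¹ * (ξ ^ 2 * q) ^ lam.card * q ^ (2 * bStat lam) *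
    ∏ c ∈ lam.cells, 1 / (1 - q ^ hook lam c) ^ 2

/-- All sets of partitions are measurable. -/
instance : MeasurableSpace YoungDiagram := ⊤

/-- The squared type `q`-Plancherel measure on the set of all partitions. -/
def measureS (ξ q : ℝ) : Measure YoungDiagram :=
  Measure.sum fun lam => ENNReal.ofReal (weight ξ q lam) • Measure.dirac lam

/-- The point configuration `Ξ(λ) = {λ_i - i + 1/2 : i ≥ 1}`, with `i` counted from `0` here. -/
def config (lam : YoungDiagram) : Set ℝ := {x | ∃ i : ℕ, x = (lam.rowLen i : ℝ) - (i + 1) + 1 / 2}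

/-- The correlation function `ρ(Z) = ℙ[Z ⊆ Ξ(λ)]` of a random partition with law `P`. -/
def correlation (P : Measure YoungDiagram) (Z : Set ℝ) : ℝ := P.real {lam | Z ⊆ config lam}

/-! ### The `q`-Bessel kernel -/

/-- The expression
`ξ (J_{r+1/2} J_{s-1/2} - J_{r-1/2} J_{s+1/2}) / (q^{(r-s)/2} - q^{-(r-s)/2})`, `J_ν = J_ν^{(3)}(2ξ; q)`,
for real `r ≠ s`. -/
def kernelQuotient (ξ q r s : ℝ) : ℝ :=
  ξ * (hahnExton (r + 1 / 2) (2 * ξ) q * hahnExton (s - 1 / 2) (2 * ξ) q -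
      hahnExton (r - 1 / 2) (2 * ξ) q * hahnExton (s + 1 / 2) (2 * ξ) q) /
    (q ^ ((r - s) / 2) - q ^ (-((r - s) / 2)))

open Classical in
/-- The `q`-Bessel kernel: the quotient above for `r ≠ s`, and its limit as `s → r` through real
`s ≠ r` on the diagonal, where the quotient reads `0 / 0`. -/
def qBesselKernel (ξ q r s : ℝ) : ℝ :=
  if r = s then limUnder (𝓝[≠] r) (fun u : ℝ => kernelQuotient ξ q r u)
  else kernelQuotient ξ q r s

end QPlancherel

end

/-!
A partition with at most `N` rows is a strictly increasing `N`-tuple of naturals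
`p_j = λ_{N-j} + j`, `j < N`, and by the hook formula `det (a_i ^ p_j) ^ 2` with `a_i = ξ √q q^i` is
a Vandermonde factor times the weight of `λ` times a ratio of `q`-Pochhammer symbols which tends to
`1` as `N → ∞`. By Cauchy–Binet the total mass of this ensemble is the Cauchy determinant of
`C = 1 / (1 - a_i a_j)`, and its correlation functions are determinants of the kernel
`∑ a_i ^ x (C⁻¹)_{ij} a_j ^ y`. Lagrange interpolation gives `C⁻¹ = D C D` with `D` diagonal, so
expanding `C` as a geometric series turns the kernel into a series in `l` of products of two finite
alternating sums. As `N → ∞` these sums converge to `q`-Bessel functions, and the three-term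
recurrence of the latter telescopes the limiting series to the `q`-Bessel kernel.
-/

noncomputable section

namespace QPlancherel

/-! ### Determinantal ensembles -/

section CauchyBinet

variable {R α : Type*} [CommRing R]

theorem det_sum_mul_eq_sum_piFinset {n : Type*} [Fintype n] [DecidableEq n] (S : Finset α)
    (f g : n → α → R) :
    Matrix.det (Matrix.of fun i j => ∑ x ∈ S, f i x * g j x) =
      ∑ p ∈ Fintype.piFinset fun _ : n => S,
        (∏ i, g i (p i)) * Matrix.det (Matrix.of fun i j => f i (p j)) := by
  simp only [Matrix.det_apply', Matrix.of_apply, Finset.prod_univ_sum, Finset.mul_sum]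
  rw [Finset.sum_comm]
  refine Finset.sum_congr rfl fun p _ => Finset.sum_congr rfl fun σ _ => ?_
  rw [Finset.prod_mul_distrib]
  ring

open Classical in
theorem sum_filter_injective_eq_sum_strictMono {M : Type*} [AddCommMonoid M] [LinearOrder α]
    {N : ℕ} (S : Finset α) (F : (Fin N → α) → M) :
    ∑ p ∈ (Fintype.piFinset fun _ : Fin N => S) with Function.Injective p, F p =
      ∑ p ∈ (Fintype.piFinset fun _ : Fin N => S) with StrictMono p,
        ∑ σ : Equiv.Perm (Fin N), F (p ∘ σ) := by
  rw [← Finset.sum_product']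
  symm
  refine Finset.sum_bij (fun x _ => x.1 ∘ x.2) ?_ ?_ ?_ fun _ _ => rfl
  · rintro ⟨s, σ⟩ hx
    simp only [Finset.mem_product, Finset.mem_filter, Fintype.mem_piFinset,
      Finset.mem_univ, and_true] at hx ⊢
    exact ⟨fun i => hx.1 _, hx.2.injective.comp σ.injective⟩
  · rintro ⟨s, σ⟩ hx ⟨t, τ⟩ hy hxy
    simp only [Finset.mem_product, Finset.mem_filter, Finset.mem_univ, and_true] at hx hy
    simp only at hxy
    obtain rfl : s = t := by
      rw [← StrictMono.range_inj hx.2 hy.2, ← σ.surjective.range_comp s, hxy,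
        τ.surjective.range_comp t]
    rw [Equiv.ext fun i => hx.2.injective (congrFun hxy i)]
  · intro p hp
    simp only [Finset.mem_filter, Fintype.mem_piFinset] at hp
    refine ⟨(p ∘ Tuple.sort p, (Tuple.sort p)⁻¹), ?_, by funext i; simp⟩
    simp only [Finset.mem_product, Finset.mem_filter, Fintype.mem_piFinset,
      Finset.mem_univ, and_true]
    exact ⟨fun i => hp.1 _, (Tuple.monotone_sort p).strictMono_of_injective
      (hp.2.comp (Tuple.sort p).injective)⟩

open Classical in
theorem det_sum_mul_eq_sum_strictMono [LinearOrder α] {N : ℕ} (S : Finset α)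
    (f g : Fin N → α → R) :
    Matrix.det (Matrix.of fun i j => ∑ x ∈ S, f i x * g j x) =
      ∑ p ∈ (Fintype.piFinset fun _ : Fin N => S) with StrictMono p,
        Matrix.det (Matrix.of fun i j => f i (p j)) *
          Matrix.det (Matrix.of fun i j => g i (p j)) := by
  have hinj : ∀ p : Fin N → α,
      (∏ i, g i (p i)) * Matrix.det (Matrix.of fun i j => f i (p j)) ≠ 0 →
        Function.Injective p := by
    intro p hp i j hij
    by_contra hne
    exact hp (by rw [Matrix.det_zero_of_column_eq hne fun k => by simp [hij], mul_zero])
  rw [det_sum_mul_eq_sum_piFinset, ← Finset.sum_filter_of_ne fun p _ => hinj p,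
    sum_filter_injective_eq_sum_strictMono]
  refine Finset.sum_congr rfl fun p _ => ?_
  rw [← Matrix.det_transpose (Matrix.of fun i j => g i (p j)),
    Matrix.det_apply' (Matrix.transpose _), Finset.mul_sum]
  refine Finset.sum_congr rfl fun σ _ => ?_
  have hσ : Matrix.det (Matrix.of fun i j => f i (p (σ j))) =
      Equiv.Perm.sign σ * Matrix.det (Matrix.of fun i j => f i (p j)) :=
    Matrix.det_permute' σ (Matrix.of fun i j => f i (p j))
  simp only [Function.comp_apply, hσ, Matrix.transpose_apply, Matrix.of_apply]
  ring

end CauchyBinet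

section Ensemble

variable {α : Type*} [LinearOrder α] {N k : ℕ}

open Classical in
/-- The weight `det (f_i(p_j))²` of a configuration `p_1 < ⋯ < p_N` of `N` points in the
orthogonal ensemble spanned by the functions `f_1, …, f_N`. It is `0` on tuples that are not
strictly increasing, so that every configuration is counted once. -/
def ensembleWeight (f : Fin N → α → ℝ) (p : Fin N → α) : ℝ :=
  if StrictMono p then Matrix.det (Matrix.of fun i j => f i (p j)) ^ 2 else 0

/-- The correlation kernel `∑ f_l(x) H_{l m} f_m(y)` of the ensemble spanned by `f_1, …, f_N`,
where `H` is the inverse of their Gram matrix. -/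
def ensembleKernel (f : Fin N → α → ℝ) (H : Matrix (Fin N) (Fin N) ℝ) (x y : α) : ℝ :=
  ∑ l, ∑ m, f l x * H l m * f m y

theorem ensembleWeight_nonneg (f : Fin N → α → ℝ) (p : Fin N → α) : 0 ≤ ensembleWeight f p := by
  unfold ensembleWeight
  split_ifs <;> positivity

theorem tendsto_piFinset_const_atTop {ι β : Type*} [Fintype ι] [DecidableEq ι] :
    Tendsto (fun S : Finset β => Fintype.piFinset fun _ : ι => S) atTop atTop := by
  classical
  refine tendsto_atTop_finset_of_monotone
    (fun S T hST => Fintype.piFinset_subset _ _ fun _ => hST) fun p => ⟨Finset.univ.image p, ?_⟩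
  exact Fintype.mem_piFinset.2 fun i => Finset.mem_image_of_mem p (Finset.mem_univ i)

theorem hasSum_of_tendsto_sum_of_nonneg {ι β : Type*} {l : Filter ι} [l.NeBot] {w : β → ℝ}
    (hw : ∀ p, 0 ≤ w p) {S : ι → Finset β} (hS : Tendsto S l atTop) {a : ℝ}
    (h : Tendsto (fun i => ∑ p ∈ S i, w p) l (𝓝 a)) : HasSum w a := by
  have hsum : Summable w := by
    refine summable_of_sum_le hw (c := a) fun T => ge_of_tendsto h ?_
    filter_upwards [hS.eventually (eventually_ge_atTop T)] with i hi
    exact Finset.sum_le_sum_of_subset_of_nonneg hi fun p _ _ => hw p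
  rw [tendsto_nhds_unique h (hsum.hasSum.comp hS)]
  exact hsum.hasSum

theorem hasSum_prod_mul_ensembleWeight (f : Fin N → α → ℝ) {u : α → ℝ} (hu : ∀ x, 0 ≤ u x)
    {G : Matrix (Fin N) (Fin N) ℝ} (hG : ∀ i j, HasSum (fun x => f i x * (u x * f j x)) (G i j)) :
    HasSum (fun p => (∏ j, u (p j)) * ensembleWeight f p) G.det := by
  refine hasSum_of_tendsto_sum_of_nonneg
    (fun p => mul_nonneg (Finset.prod_nonneg fun j _ => hu _) (ensembleWeight_nonneg f p))
    tendsto_piFinset_const_atTop ?_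
  have hdet : Continuous fun M : Matrix (Fin N) (Fin N) ℝ => M.det := continuous_id.matrix_det
  refine ((hdet.tendsto G).comp
    (tendsto_pi_nhds.2 fun i => tendsto_pi_nhds.2 fun j => hG i j)).congr fun S => ?_
  refine (det_sum_mul_eq_sum_strictMono S f fun j x => u x * f j x).trans ?_
  rw [Finset.sum_filter]
  refine Finset.sum_congr rfl fun p _ => ?_
  rw [ensembleWeight, mul_ite, mul_zero]
  refine if_congr Iff.rfl ?_ rfl
  have hrow := Matrix.det_mul_row (fun j => u (p j)) (Matrix.of fun i j => f i (p j))
  simp only [Matrix.of_apply] at hrow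
  rw [hrow]
  ring

theorem summable_ensembleWeight (f : Fin N → α → ℝ)
    (hf : ∀ i j, Summable fun x => f i x * f j x) : Summable (ensembleWeight f) := by
  simpa using (hasSum_prod_mul_ensembleWeight f (u := 1) (fun _ => zero_le_one)
    (G := Matrix.of fun i j => ∑' x, f i x * f j x)
    fun i j => by simpa using (hf i j).hasSum).summable

open Classical in
/-- The number of points of the configuration `p` that lie among the points `z`. -/
def occupation (z : Fin k → α) (p : Fin N → α) : ℕ :=
  (Finset.univ.filter fun j => p j ∈ Set.range z).card

open Classical in
theorem occupation_eq_card_inter (z : Fin k → α) {p : Fin N → α} (hp : Function.Injective p) :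
    occupation z p = (Finset.univ.image p ∩ Finset.univ.image z).card := by
  rw [occupation, ← Finset.card_image_of_injective _ hp, Finset.filter_mem_eq_inter.symm,
    Finset.filter_image]
  simp

theorem occupation_le (z : Fin k → α) {p : Fin N → α} (hp : Function.Injective p) :
    occupation z p ≤ k := by
  classical
  rw [occupation_eq_card_inter z hp]
  exact (Finset.card_le_card Finset.inter_subset_right).trans
    (Finset.card_image_le.trans_eq (Finset.card_fin k))

theorem occupation_eq_iff {z : Fin k → α} (hz : Function.Injective z) {p : Fin N → α}
    (hp : Function.Injective p) : occupation z p = k ↔ Set.range z ⊆ Set.range p := by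
  classical
  have hk : (Finset.univ.image z).card = k := by
    rw [Finset.card_image_of_injective _ hz, Finset.card_fin]
  have hcard : (Finset.univ.image p ∩ Finset.univ.image z).card = k ↔
      Finset.univ.image p ∩ Finset.univ.image z = Finset.univ.image z :=
    ⟨fun h => Finset.eq_of_subset_of_card_le Finset.inter_subset_right (hk.trans h.symm).le,
      fun h => (congrArg Finset.card h).trans hk⟩
  rw [occupation_eq_card_inter z hp, hcard, Finset.inter_eq_right]
  simp [← Finset.coe_subset]

theorem hasSum_ite_mem_range_mul {ι β : Type*} [Fintype ι] {z : ι → β}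
    [DecidablePred (· ∈ Set.range z)] (hz : Function.Injective z) {g : β → ℝ} {a : ℝ}
    (hg : HasSum g a) (t : ℝ) :
    HasSum (fun x => (if x ∈ Set.range z then t else 1) * g x) (a + (t - 1) * ∑ i, g (z i)) := by
  classical
  have hpoints : HasSum (fun x => ∑ i, if x = z i then (t - 1) * g (z i) else 0)
      (∑ i, (t - 1) * g (z i)) :=
    hasSum_sum fun i _ => hasSum_ite_eq (z i) _
  rw [Finset.mul_sum]
  refine HasSum.congr_fun (hg.add hpoints) fun x => ?_
  by_cases hx : x ∈ Set.range z
  · obtain ⟨i, rfl⟩ := hx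
    simp only [Set.mem_range_self, if_true, hz.eq_iff, Finset.sum_ite_eq, Finset.mem_univ]
    ring
  · have hne : ∀ i, x ≠ z i := fun i h => hx ⟨i, h.symm⟩
    simp [hx, hne]

section Kernel

variable {f : Fin N → α → ℝ} {G H : Matrix (Fin N) (Fin N) ℝ} {z : Fin k → α}

theorem hasSum_pow_occupation_mul_ensembleWeight
    (hG : ∀ i j, HasSum (fun x => f i x * f j x) (G i j)) (hGH : G * H = 1)
    (hz : Function.Injective z) {t : ℝ} (ht : 0 ≤ t) :
    HasSum (fun p => t ^ occupation z p * ensembleWeight f p)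
      (G.det * Matrix.det
        (1 + (t - 1) • Matrix.of fun i j : Fin k => ensembleKernel f H (z i) (z j))) := by
  classical
  let Φ : Matrix (Fin N) (Fin k) ℝ := Matrix.of fun i l => f i (z l)
  have hK : (Matrix.of fun i j : Fin k => ensembleKernel f H (z i) (z j)) =
      Φ.transpose * (H * Φ) := by
    rw [← Matrix.mul_assoc]
    ext i j
    simp only [ensembleKernel, Φ, Matrix.mul_apply, Matrix.of_apply, Matrix.transpose_apply,
      Finset.sum_mul]
    exact Finset.sum_comm
  have hgram : ∀ i j, HasSum (fun x => f i x * ((if x ∈ Set.range z then t else 1) * f j x))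
      ((G + (t - 1) • (Φ * Φ.transpose)) i j) := by
    intro i j
    have hij := hasSum_ite_mem_range_mul hz (hG i j) t
    refine HasSum.congr_fun hij fun x => ?_
    ring
  have hdet : G.det * Matrix.det (1 + (t - 1) • (Φ.transpose * (H * Φ))) =
      (G + (t - 1) • (Φ * Φ.transpose)).det := by
    rw [← Matrix.smul_mul, Matrix.det_one_add_mul_comm, ← Matrix.det_mul, Matrix.mul_add,
      Matrix.mul_one, ← Matrix.mul_assoc, ← Matrix.mul_assoc, hGH, Matrix.one_mul,
      Matrix.mul_smul]
  rw [hK, hdet]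
  refine HasSum.congr_fun (hasSum_prod_mul_ensembleWeight f
    (fun x => by split_ifs <;> [exact ht; exact zero_le_one]) hgram) fun p => ?_
  rw [Finset.prod_ite, Finset.prod_const, Finset.prod_const_one, mul_one, occupation]

/- Multiplying the generating function at `t = 1 / ε` by `ε ^ k` isolates, as `ε → 0`, the
configurations that occupy all `k` points. -/
theorem hasSum_pow_sub_occupation_mul_ensembleWeight
    (hG : ∀ i j, HasSum (fun x => f i x * f j x) (G i j)) (hGH : G * H = 1)
    (hz : Function.Injective z) {ε : ℝ} (hε : 0 < ε) :
    HasSum (fun p => ε ^ (k - occupation z p) * ensembleWeight f p)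
      (G.det * Matrix.det (ε • (1 : Matrix (Fin k) (Fin k) ℝ) +
        (1 - ε) • Matrix.of fun i j : Fin k => ensembleKernel f H (z i) (z j))) := by
  have h := (hasSum_pow_occupation_mul_ensembleWeight hG hGH hz
    (inv_nonneg.2 hε.le)).mul_left (ε ^ k)
  set K := Matrix.of fun i j : Fin k => ensembleKernel f H (z i) (z j)
  have hscale : ε • (1 : Matrix (Fin k) (Fin k) ℝ) + (1 - ε) • K =
      ε • (1 + (ε⁻¹ - 1) • K) := by
    rw [smul_add, smul_smul, mul_sub, mul_inv_cancel₀ hε.ne', mul_one]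
  rw [hscale, Matrix.det_smul, Fintype.card_fin, mul_left_comm]
  refine HasSum.congr_fun h fun p => ?_
  by_cases hp : StrictMono p
  · rw [← mul_assoc, pow_sub₀ _ hε.ne' (occupation_le z hp.injective), inv_pow]
  · simp [ensembleWeight, hp]

theorem tendsto_tsum_pow_mul {β : Type*} {w : β → ℝ} (hw : Summable w) (n : β → ℕ) :
    Tendsto (fun ε : ℝ => ∑' p, ε ^ n p * w p) (𝓝[>] 0) (𝓝 (∑' p, 0 ^ n p * w p)) := by
  refine tendsto_tsum_of_dominated_convergence hw.norm (fun p => ?_) ?_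
  · have hcont : Continuous fun ε : ℝ => ε ^ n p * w p := by fun_prop
    exact (hcont.tendsto 0).mono_left nhdsWithin_le_nhds
  · filter_upwards [Ioo_mem_nhdsGT (zero_lt_one' ℝ)] with ε hε p
    rw [norm_mul, norm_pow, Real.norm_of_nonneg hε.1.le]
    exact mul_le_of_le_one_left (norm_nonneg _) (pow_le_one₀ hε.1.le hε.2.le)

open Classical in
theorem hasSum_ensembleWeight_of_range_subset
    (hG : ∀ i j, HasSum (fun x => f i x * f j x) (G i j)) (hGH : G * H = 1)
    (hz : Function.Injective z) :
    HasSum (fun p => if Set.range z ⊆ Set.range p then ensembleWeight f p else 0)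
      (G.det * Matrix.det (Matrix.of fun i j : Fin k => ensembleKernel f H (z i) (z j))) := by
  have hw := summable_ensembleWeight f fun i j => (hG i j).summable
  set K := Matrix.of fun i j : Fin k => ensembleKernel f H (z i) (z j)
  have hite : (fun p => if Set.range z ⊆ Set.range p then ensembleWeight f p else 0) =
      fun p => 0 ^ (k - occupation z p) * ensembleWeight f p := by
    funext p
    by_cases hp : StrictMono p
    · have hle := occupation_le z hp.injective
      rw [← occupation_eq_iff hz hp.injective]
      rcases hle.eq_or_lt with h | h
      · simp [h]
      · simp [h.ne, (Nat.sub_pos_of_lt h).ne']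
    · simp [ensembleWeight, hp]
  have hcont : Continuous fun ε : ℝ => G.det *
      Matrix.det (ε • (1 : Matrix (Fin k) (Fin k) ℝ) + (1 - ε) • K) :=
    continuous_const.mul (Continuous.matrix_det (by fun_prop))
  have hlim := (hcont.tendsto 0).mono_left (nhdsWithin_le_nhds (s := Set.Ioi 0))
  simp only [zero_smul, zero_add, sub_zero, one_smul] at hlim
  have hlim' := (tendsto_tsum_pow_mul hw fun p => k - occupation z p).congr' <|
    eventually_mem_nhdsWithin.mono fun ε hε =>
      (hasSum_pow_sub_occupation_mul_ensembleWeight hG hGH hz hε).tsum_eq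
  rw [tendsto_nhds_unique hlim hlim', hite]
  refine Summable.hasSum (hite ▸ hw.of_nonneg_of_le (fun p => ?_) fun p => ?_)
  · split_ifs <;> [exact ensembleWeight_nonneg f p; exact le_rfl]
  · split_ifs <;> [exact le_rfl; exact ensembleWeight_nonneg f p]

end Kernel

end Ensemble

/-! ### The inverse of a symmetric Cauchy matrix -/

section Cauchy

variable {F ι : Type*} [Field F] [Fintype ι] [DecidableEq ι]

/-- The symmetric Cauchy matrix with entries `1 / (1 - a_i a_j)`. -/
def cauchyMatrix (a : ι → F) : Matrix ι ι F := Matrix.of fun i j => (1 - a i * a j)⁻¹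

/-- The numbers `d_i = ∏_j (1 - a_i a_j) / ∏_{j ≠ i} (a_i - a_j)` that conjugate a symmetric Cauchy
matrix into its inverse. -/
def cauchyCoeff (a : ι → F) (i : ι) : F :=
  (∏ j, (1 - a i * a j)) * (∏ j ∈ Finset.univ.erase i, (a i - a j))⁻¹

/-- The inverse of the symmetric Cauchy matrix `C` of `a`, in the form `D C D` with `D` diagonal. -/
def cauchyInverse (a : ι → F) : Matrix ι ι F :=
  Matrix.diagonal (cauchyCoeff a) * cauchyMatrix a * Matrix.diagonal (cauchyCoeff a)

theorem cauchyInverse_apply (a : ι → F) (i j : ι) :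
    cauchyInverse a i j = cauchyCoeff a i * (1 - a i * a j)⁻¹ * cauchyCoeff a j := by
  rw [cauchyInverse, Matrix.mul_diagonal, Matrix.diagonal_mul, cauchyMatrix, Matrix.of_apply]

/- Lagrange interpolation of `P` at the nodes `a_j`, evaluated at `b⁻¹`. -/
theorem sum_eval_mul_inv_eq {a : ι → F} (ha : Function.Injective a) {P : Polynomial F}
    (hP : P.degree < Fintype.card ι) {b : F} (hb : b ≠ 0) (hab : ∀ j, 1 - b * a j ≠ 0) :
    ∑ j, P.eval (a j) * (∏ m ∈ Finset.univ.erase j, (a j - a m))⁻¹ * (1 - b * a j)⁻¹ =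
      b ^ (Fintype.card ι - 1) * P.eval b⁻¹ * (∏ m, (1 - b * a m))⁻¹ := by
  rcases isEmpty_or_nonempty ι with hι | hι
  · obtain rfl : P = 0 := by simpa [Fintype.card_eq_zero] using hP
    simp
  have hsub : ∀ m, b⁻¹ - a m = b⁻¹ * (1 - b * a m) := fun m => by field_simp
  have heval := Lagrange.eval_interpolate_not_at_node (s := Finset.univ) (v := a) (x := b⁻¹)
    (fun j => P.eval (a j)) fun j _ => by
      rw [← sub_ne_zero, hsub]; exact mul_ne_zero (inv_ne_zero hb) (hab j)
  rw [← Lagrange.eq_interpolate ha.injOn (by simpa using hP), Lagrange.eval_nodal] at heval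
  simp only [hsub, Finset.prod_mul_distrib, Finset.prod_const, Finset.card_univ, mul_inv, inv_inv,
    Lagrange.nodalWeight, Finset.prod_inv_distrib] at heval
  have hprod : ∏ m, (1 - b * a m) ≠ 0 := Finset.prod_ne_zero_iff.2 fun m _ => hab m
  have hpow : b ^ Fintype.card ι = b ^ (Fintype.card ι - 1) * b := by
    rw [← pow_succ, Nat.sub_add_cancel Fintype.card_pos]
  set T := ∑ j, P.eval (a j) * (∏ m ∈ Finset.univ.erase j, (a j - a m))⁻¹ * (1 - b * a j)⁻¹
    with hT
  have hsum : ∑ j, (∏ m ∈ Finset.univ.erase j, (a j - a m))⁻¹ * (b * (1 - b * a j)⁻¹) *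
      P.eval (a j) = b * T := by
    rw [hT, Finset.mul_sum]
    exact Finset.sum_congr rfl fun j _ => by ring
  rw [hsum] at heval
  rw [heval, inv_pow, hpow]
  clear_value T
  field_simp

theorem degree_prod_erase_lt (a : ι → F) (i : ι) :
    (∏ m ∈ Finset.univ.erase i, (1 - Polynomial.C (a m) * Polynomial.X)).degree <
      (Fintype.card ι : WithBot ℕ) := by
  have hfactor : ∀ m, (1 - Polynomial.C (a m) * Polynomial.X).natDegree ≤ 1 := fun m => by
    compute_degree
  refine Polynomial.degree_le_natDegree.trans_lt ?_
  rw [Nat.cast_lt]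
  calc (∏ m ∈ Finset.univ.erase i, (1 - Polynomial.C (a m) * Polynomial.X)).natDegree
      ≤ ∑ m ∈ Finset.univ.erase i, 1 :=
        (Polynomial.natDegree_prod_le _ _).trans (Finset.sum_le_sum fun m _ => hfactor m)
    _ < Fintype.card ι := by
        rw [Finset.sum_const, smul_eq_mul, mul_one]
        exact Finset.card_erase_lt_of_mem (Finset.mem_univ i)

theorem sum_cauchyCoeff_mul_inv {a : ι → F} (ha : Function.Injective a) (h0 : ∀ i, a i ≠ 0)
    (h1 : ∀ i j, 1 - a i * a j ≠ 0) (i k : ι) :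
    ∑ j, cauchyCoeff a j * (1 - a i * a j)⁻¹ * (1 - a k * a j)⁻¹ =
      (∏ m ∈ Finset.univ.erase i, (a k - a m)) * (∏ m, (1 - a k * a m))⁻¹ := by
  set P : Polynomial F := ∏ m ∈ Finset.univ.erase i, (1 - Polynomial.C (a m) * Polynomial.X)
  have hP : ∀ x, P.eval x = ∏ m ∈ Finset.univ.erase i, (1 - a m * x) := fun x => by
    simp [P, Polynomial.eval_prod]
  have hcoeff : ∀ j, cauchyCoeff a j * (1 - a i * a j)⁻¹ =
      P.eval (a j) * (∏ m ∈ Finset.univ.erase j, (a j - a m))⁻¹ := by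
    intro j
    rw [cauchyCoeff, hP, ← Finset.mul_prod_erase _ (fun m => 1 - a j * a m) (Finset.mem_univ i),
      mul_comm (a j) (a i), mul_comm, ← mul_assoc, inv_mul_cancel_left₀ (h1 i j)]
    simp only [mul_comm]
  have hhom : a k ^ (Fintype.card ι - 1) * P.eval (a k)⁻¹ =
      ∏ m ∈ Finset.univ.erase i, (a k - a m) := by
    rw [hP, ← Finset.card_univ, ← Finset.card_erase_of_mem (Finset.mem_univ i),
      ← Finset.prod_const, ← Finset.prod_mul_distrib]
    refine Finset.prod_congr rfl fun m _ => ?_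
    rw [mul_sub, mul_one, mul_left_comm, mul_inv_cancel₀ (h0 k), mul_one]
  simp only [hcoeff]
  rw [sum_eval_mul_inv_eq ha (degree_prod_erase_lt a i) (h0 k) (h1 k), hhom]

theorem cauchyMatrix_mul_cauchyInverse {a : ι → F} (ha : Function.Injective a)
    (h0 : ∀ i, a i ≠ 0) (h1 : ∀ i j, 1 - a i * a j ≠ 0) :
    cauchyMatrix a * cauchyInverse a = 1 := by
  ext i k
  have hsum : (cauchyMatrix a * cauchyInverse a) i k =
      (∑ j, cauchyCoeff a j * (1 - a i * a j)⁻¹ * (1 - a k * a j)⁻¹) * cauchyCoeff a k := by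
    rw [Matrix.mul_apply, Finset.sum_mul]
    refine Finset.sum_congr rfl fun j _ => ?_
    rw [cauchyInverse_apply, cauchyMatrix, Matrix.of_apply, mul_comm (a k) (a j)]
    ring
  rw [hsum, sum_cauchyCoeff_mul_inv ha h0 h1, cauchyCoeff]
  rcases eq_or_ne i k with rfl | hik
  · have hdiff : ∏ m ∈ Finset.univ.erase i, (a i - a m) ≠ 0 :=
      Finset.prod_ne_zero_iff.2 fun m hm => sub_ne_zero.2 (ha.ne (Finset.ne_of_mem_erase hm).symm)
    have hprod : ∏ m, (1 - a i * a m) ≠ 0 := Finset.prod_ne_zero_iff.2 fun m _ => h1 i m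
    rw [Matrix.one_apply_eq]
    field_simp
  · rw [Matrix.one_apply_ne hik, Finset.prod_eq_zero (i := k)
      (Finset.mem_erase.2 ⟨hik.symm, Finset.mem_univ k⟩) (sub_self _), zero_mul, zero_mul]

end Cauchy

/-! ### Partitions with at most `N` rows -/

theorem rowLen_eq_zero {lam : YoungDiagram} {i : ℕ} (h : lam.colLen 0 ≤ i) : lam.rowLen i = 0 := by
  by_contra hne
  have hmem : (i, 0) ∈ lam := YoungDiagram.mem_iff_lt_rowLen.2 (Nat.pos_of_ne_zero hne)
  exact (YoungDiagram.mem_iff_lt_colLen.1 hmem).not_ge h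

@[to_additive]
theorem prod_cells {M : Type*} [CommMonoid M] {lam : YoungDiagram} {N : ℕ}
    (hN : lam.colLen 0 ≤ N) (f : ℕ × ℕ → M) :
    ∏ c ∈ lam.cells, f c = ∏ i ∈ Finset.range N, ∏ j ∈ Finset.range (lam.rowLen i), f (i, j) := by
  refine Finset.prod_finset_product _ _ (fun i => Finset.range (lam.rowLen i)) ?_
  rintro ⟨i, j⟩
  rw [YoungDiagram.mem_cells, YoungDiagram.mem_iff_lt_rowLen, Finset.mem_range, Finset.mem_range]
  refine ⟨fun h => ⟨?_, h⟩, And.right⟩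
  by_contra hi
  exact Nat.not_lt_zero _ (rowLen_eq_zero (hN.trans (not_lt.1 hi)) ▸ h)

theorem card_eq_sum_rowLen {lam : YoungDiagram} {N : ℕ} (hN : lam.colLen 0 ≤ N) :
    lam.card = ∑ i ∈ Finset.range N, lam.rowLen i := by
  rw [YoungDiagram.card, Finset.card_eq_sum_ones, sum_cells hN]
  simp only [Finset.sum_const, Finset.card_range, smul_eq_mul, mul_one]

theorem bStat_eq_sum {lam : YoungDiagram} {N : ℕ} (hN : lam.colLen 0 ≤ N) :
    bStat lam = ∑ i ∈ Finset.range N, i * lam.rowLen i := by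
  refine Finset.sum_subset (Finset.range_mono hN) fun i _ hi => ?_
  rw [rowLen_eq_zero (not_lt.1 (mt Finset.mem_range.2 hi)), mul_zero]

/-- The increasing tuple `λ_{N - j} + j` of shifted row lengths, which encodes a partition with at
most `N` rows. -/
def shiftedRows (N : ℕ) (lam : YoungDiagram) (j : Fin N) : ℕ := lam.rowLen j.rev + j

theorem strictMono_shiftedRows (N : ℕ) (lam : YoungDiagram) : StrictMono (shiftedRows N lam) :=
  fun i j hij => Nat.add_lt_add_of_le_of_lt
    (lam.rowLen_anti j.rev i.rev (Fin.rev_le_rev.2 hij.le)) hij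

theorem shiftedRows_bot (N : ℕ) : shiftedRows N ⊥ = fun j : Fin N => (j : ℕ) := by
  funext j
  have hrow : (⊥ : YoungDiagram).rowLen j.rev = 0 := by
    by_contra hne
    exact YoungDiagram.notMem_bot _ (YoungDiagram.mem_iff_lt_rowLen.2 (Nat.pos_of_ne_zero hne))
  rw [shiftedRows, hrow, zero_add]

theorem colLen_bot (j : ℕ) : (⊥ : YoungDiagram).colLen j = 0 := by
  by_contra hne
  exact YoungDiagram.notMem_bot _ (YoungDiagram.mem_iff_lt_colLen.2 (Nat.pos_of_ne_zero hne))

theorem shiftedRows_injOn (N : ℕ) :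
    Set.InjOn (shiftedRows N) {lam : YoungDiagram | lam.colLen 0 ≤ N} := by
  intro lam hlam mu hmu h
  have hrow (i : ℕ) : lam.rowLen i = mu.rowLen i := by
    rcases lt_or_ge i N with hi | hi
    · have hi' := congrFun h (Fin.rev ⟨i, hi⟩)
      simpa only [shiftedRows, Fin.rev_rev, Nat.add_right_cancel_iff] using hi'
    · rw [rowLen_eq_zero (le_trans hlam hi), rowLen_eq_zero (le_trans hmu hi)]
  refine YoungDiagram.ext (Finset.ext fun c => ?_)
  rw [YoungDiagram.mem_cells, YoungDiagram.mem_cells, YoungDiagram.mem_iff_lt_rowLen,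
    YoungDiagram.mem_iff_lt_rowLen, hrow]

theorem add_sub_le_of_strictMono {N : ℕ} {p : Fin N → ℕ} (hp : StrictMono p) {i j : Fin N}
    (hij : i ≤ j) : p i + (j - i : ℕ) ≤ p j := by
  have hcard := Finset.card_le_card_of_injOn p (s := Finset.Ico i j) (t := Finset.Ico (p i) (p j))
    (fun x hx => by
      rw [Finset.coe_Ico, Set.mem_Ico] at hx ⊢
      exact ⟨hp.monotone hx.1, hp hx.2⟩) hp.injective.injOn
  have hle := hp.monotone hij
  rw [Fin.card_Ico, Nat.card_Ico] at hcard
  omega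

theorem val_le_of_strictMono {N : ℕ} {p : Fin N → ℕ} (hp : StrictMono p) (i : Fin N) :
    (i : ℕ) ≤ p i := by
  have h := add_sub_le_of_strictMono hp (i := ⟨0, i.pos⟩) (Fin.mk_le_of_le_val (Nat.zero_le i))
  simp only [tsub_zero] at h
  omega

theorem exists_shiftedRows_eq {N : ℕ} {p : Fin N → ℕ} (hp : StrictMono p) :
    ∃ lam : YoungDiagram, lam.colLen 0 ≤ N ∧ shiftedRows N lam = p := by
  have hanti : Antitone fun i : Fin N => p i.rev - (i.rev : ℕ) := by
    intro i j hij
    have hji : j.rev ≤ i.rev := Fin.rev_le_rev.2 hij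
    have h := add_sub_le_of_strictMono hp hji
    have := Fin.le_def.1 hji
    simp only
    omega
  let w := List.ofFn fun i : Fin N => p i.rev - (i.rev : ℕ)
  have hw : w.length = N := List.length_ofFn
  refine ⟨YoungDiagram.ofRowLens w hanti.sortedGE_ofFn, ?_, ?_⟩
  · by_contra hcon
    obtain ⟨hlt, -⟩ := YoungDiagram.mem_ofRowLens.1
      (YoungDiagram.mem_iff_lt_colLen.2 (not_le.1 hcon))
    exact (hw ▸ hlt).false
  · funext j
    have hrow := YoungDiagram.rowLen_ofRowLens (hw := hanti.sortedGE_ofFn) (Fin.cast hw.symm j.rev)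
    simp only [Fin.val_cast, w, Fin.getElem_fin, List.getElem_ofFn, Fin.eta, Fin.rev_rev] at hrow
    rw [shiftedRows, hrow, Nat.sub_add_cancel (val_le_of_strictMono hp j)]

theorem hasSum_youngDiagram {N : ℕ} {F : YoungDiagram → ℝ} {G : (Fin N → ℕ) → ℝ} {x : ℝ}
    (hF : ∀ lam : YoungDiagram, ¬ lam.colLen 0 ≤ N → F lam = 0)
    (hG : ∀ p, ¬ StrictMono p → G p = 0)
    (hFG : ∀ lam : YoungDiagram, lam.colLen 0 ≤ N → F lam = G (shiftedRows N lam))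
    (h : HasSum G x) : HasSum F x := by
  have hinj : Function.Injective fun lam : {lam : YoungDiagram | lam.colLen 0 ≤ N} =>
      shiftedRows N lam := (shiftedRows_injOn N).injective
  have hsub : HasSum (fun lam : {lam : YoungDiagram | lam.colLen 0 ≤ N} =>
      G (shiftedRows N lam)) x := by
    refine (hinj.hasSum_iff fun p hp => hG p fun hmono => hp ?_).2 h
    obtain ⟨lam, hlam, rfl⟩ := exists_shiftedRows_eq hmono
    exact ⟨⟨lam, hlam⟩, rfl⟩
  refine (hasSum_subtype_iff_of_support_subset
    (s := {lam : YoungDiagram | lam.colLen 0 ≤ N}) fun lam hlam => ?_).1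
    (hsub.congr_fun fun lam => hFG lam lam.2)
  by_contra hcon
  exact hlam (hF lam hcon)

/-! ### Hook lengths -/

theorem hook_pos {lam : YoungDiagram} {c : ℕ × ℕ} (hc : c ∈ lam.cells) : 0 < hook lam c := by
  have hrow := YoungDiagram.mem_iff_lt_rowLen.1 hc
  have hcol := YoungDiagram.mem_iff_lt_colLen.1 hc
  simp only [hook]
  omega

theorem lt_colLen_of_lt_rowLen {lam : YoungDiagram} {r j : ℕ} (hj : j < lam.rowLen r) :
    r < lam.colLen j :=
  YoungDiagram.mem_iff_lt_colLen.1 (YoungDiagram.mem_iff_lt_rowLen.2 hj)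

theorem strictAntiOn_hook (lam : YoungDiagram) (r : ℕ) :
    StrictAntiOn (fun j => hook lam (r, j)) (Finset.range (lam.rowLen r)) := by
  intro i _ j hj hij
  have hj' : j < lam.rowLen r := by simpa only [Finset.coe_range, Set.mem_Iio] using hj
  have hcol := lt_colLen_of_lt_rowLen hj'
  have hanti := lam.colLen_anti i j hij.le
  simp only [hook]
  omega

theorem hook_ne {lam : YoungDiagram} {r i j : ℕ} (hj : j < lam.rowLen r) (hi : r < i) :
    hook lam (r, j) ≠ lam.rowLen r + i - (lam.rowLen i + r) := by
  have hcol := lt_colLen_of_lt_rowLen hj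
  have hanti := lam.rowLen_anti r i hi.le
  simp only [hook]
  by_cases hij : j < lam.rowLen i
  · have := lt_colLen_of_lt_rowLen hij
    omega
  · have : ¬ i < lam.colLen j := fun h =>
      hij (YoungDiagram.mem_iff_lt_rowLen.1 (YoungDiagram.mem_iff_lt_colLen.2 h))
    omega

theorem hook_le_shiftedRows {N : ℕ} {lam : YoungDiagram} (hN : lam.colLen 0 ≤ N) {j : Fin N}
    {k : ℕ} (hk : k < lam.rowLen j.rev) : hook lam (j.rev, k) ≤ shiftedRows N lam j := by
  have hcol := lam.colLen_anti 0 k (Nat.zero_le k)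
  have hrev := Fin.val_rev j
  simp only [hook, shiftedRows]
  omega

theorem hook_ne_sub_shiftedRows {N : ℕ} {lam : YoungDiagram} {i j : Fin N} (hij : i < j)
    {k : ℕ} (hk : k < lam.rowLen j.rev) :
    hook lam (j.rev, k) ≠ shiftedRows N lam j - shiftedRows N lam i := by
  have hrev : (j.rev : ℕ) < i.rev := Fin.rev_lt_rev.2 hij
  have hne := hook_ne hk hrev
  have hi := Fin.val_rev i
  have hj := Fin.val_rev j
  simp only [shiftedRows]
  omega

theorem injOn_sub_shiftedRows {N : ℕ} (lam : YoungDiagram) (j : Fin N) :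
    Set.InjOn (fun i => shiftedRows N lam j - shiftedRows N lam i) (Finset.Iio j) := by
  intro i hi i' hi' h
  have hp := strictMono_shiftedRows N lam
  have hij := hp (Finset.mem_Iio.1 hi)
  have hij' := hp (Finset.mem_Iio.1 hi')
  refine hp.injective ?_
  simp only at h
  omega

theorem disjoint_image_hook_image_sub {N : ℕ} (lam : YoungDiagram) (j : Fin N) :
    Disjoint ((Finset.range (lam.rowLen j.rev)).image fun k => hook lam (j.rev, k))
      ((Finset.Iio j).image fun i => shiftedRows N lam j - shiftedRows N lam i) := by
  rw [Finset.disjoint_left]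
  intro x hx hx'
  obtain ⟨k, hk, rfl⟩ := Finset.mem_image.1 hx
  obtain ⟨i, hi, hik⟩ := Finset.mem_image.1 hx'
  exact hook_ne_sub_shiftedRows (Finset.mem_Iio.1 hi) (Finset.mem_range.1 hk) hik.symm

theorem image_hook_union_image_sub {N : ℕ} {lam : YoungDiagram} (hN : lam.colLen 0 ≤ N)
    (j : Fin N) :
    ((Finset.range (lam.rowLen j.rev)).image fun k => hook lam (j.rev, k)) ∪
        (Finset.Iio j).image (fun i => shiftedRows N lam j - shiftedRows N lam i) =
      Finset.Icc 1 (shiftedRows N lam j) := by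
  refine Finset.eq_of_subset_of_card_le (fun x hx => Finset.mem_Icc.2 ?_) ?_
  · rcases Finset.mem_union.1 hx with hx | hx
    · obtain ⟨k, hk, rfl⟩ := Finset.mem_image.1 hx
      have hk' := Finset.mem_range.1 hk
      exact ⟨hook_pos (YoungDiagram.mem_iff_lt_rowLen.2 hk'), hook_le_shiftedRows hN hk'⟩
    · obtain ⟨i, hi, rfl⟩ := Finset.mem_image.1 hx
      have hij := strictMono_shiftedRows N lam (Finset.mem_Iio.1 hi)
      omega
  · rw [Finset.card_union_of_disjoint (disjoint_image_hook_image_sub lam j),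
      Finset.card_image_of_injOn (strictAntiOn_hook lam j.rev).injOn,
      Finset.card_image_of_injOn (injOn_sub_shiftedRows lam j), Nat.card_Icc, Finset.card_range,
      Fin.card_Iio, Nat.add_sub_cancel, shiftedRows]

theorem prod_hook_row {M : Type*} [CommMonoid M] {N : ℕ} {lam : YoungDiagram}
    (hN : lam.colLen 0 ≤ N) (j : Fin N) (f : ℕ → M) :
    (∏ k ∈ Finset.range (lam.rowLen j.rev), f (hook lam (j.rev, k))) *
        ∏ i ∈ Finset.Iio j, f (shiftedRows N lam j - shiftedRows N lam i) =
      ∏ k ∈ Finset.Icc 1 (shiftedRows N lam j), f k := by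
  rw [← image_hook_union_image_sub hN, Finset.prod_union (disjoint_image_hook_image_sub lam j),
    Finset.prod_image (strictAntiOn_hook lam j.rev).injOn,
    Finset.prod_image (injOn_sub_shiftedRows lam j)]

theorem prod_hook {M : Type*} [CommMonoid M] {N : ℕ} {lam : YoungDiagram}
    (hN : lam.colLen 0 ≤ N) (f : ℕ → M) :
    (∏ c ∈ lam.cells, f (hook lam c)) *
        ∏ j : Fin N, ∏ i ∈ Finset.Iio j, f (shiftedRows N lam j - shiftedRows N lam i) =
      ∏ j : Fin N, ∏ k ∈ Finset.Icc 1 (shiftedRows N lam j), f k := by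
  rw [prod_cells hN, Finset.prod_range, ← Equiv.prod_comp Fin.revPerm, ← Finset.prod_mul_distrib]
  exact Finset.prod_congr rfl fun j _ => prod_hook_row hN j f

/-! ### The weight of a partition as a squared determinant -/

theorem qPoch_self (q : ℝ) (n : ℕ) : qPoch q q n = ∏ k ∈ Finset.Icc 1 n, (1 - q ^ k) := by
  rw [qPoch, ← Finset.Ico_add_one_right_eq_Icc, Finset.prod_Ico_eq_prod_range,
    Nat.add_sub_cancel]
  simp only [add_comm 1, pow_succ']

theorem qPoch_self_pos {q : ℝ} (hq : 0 < q) (hq1 : q < 1) (n : ℕ) : 0 < qPoch q q n := by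
  rw [qPoch_self]
  refine Finset.prod_pos fun k hk => sub_pos.2 (pow_lt_one₀ hq.le hq1 ?_)
  exact (Nat.one_le_iff_ne_zero.1 (Finset.mem_Icc.1 hk).1)

/-- The generalized Vandermonde determinant `det (a_i ^ p_j)`. -/
def alternant {N : ℕ} (a : Fin N → ℝ) (p : Fin N → ℕ) : ℝ :=
  Matrix.det (Matrix.of fun i j => a i ^ p j)

/-- The geometric progression `c, c q, c q², …`; with `c² = ξ² q` these are the parameters of the
determinantal ensemble that carries the measure on partitions with at most `N` rows. -/
def geomParam (c q : ℝ) (N : ℕ) (i : Fin N) : ℝ := c * q ^ (i : ℕ)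

/-- The weight of a partition before normalization by the MacMahon function. -/
def rawWeight (ξ q : ℝ) (lam : YoungDiagram) : ℝ :=
  (ξ ^ 2 * q) ^ lam.card * q ^ (2 * bStat lam) * ∏ c ∈ lam.cells, 1 / (1 - q ^ hook lam c) ^ 2

/-- The ratio, up to normalization, of the weight of a partition in the ensemble with `N` rows to
`rawWeight`. -/
def rowRatio (q : ℝ) (N : ℕ) (lam : YoungDiagram) : ℝ :=
  ∏ j : Fin N, (qPoch q q (shiftedRows N lam j) / qPoch q q j) ^ 2

theorem alternant_geomParam {N : ℕ} (c q : ℝ) (p : Fin N → ℕ) :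
    alternant (geomParam c q N) p =
      (∏ j, c ^ p j) * ∏ j, ∏ i ∈ Finset.Iio j, (q ^ p j - q ^ p i) := by
  have hswap : ∏ j, ∏ i ∈ Finset.Iio j, (q ^ p j - q ^ p i) =
      ∏ i, ∏ j ∈ Finset.Ioi i, (q ^ p j - q ^ p i) := Finset.prod_comm' (by simp)
  rw [hswap, ← Matrix.det_vandermonde, ← Matrix.det_transpose, ← Matrix.det_mul_row, alternant]
  congr 1
  ext i j
  simp only [Matrix.of_apply, Matrix.transpose_apply, Matrix.vandermonde_apply, geomParam]
  rw [mul_pow, ← pow_mul, ← pow_mul, mul_comm (p j)]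

theorem prod_pow_sub_pow {N : ℕ} (q : ℝ) {p : Fin N → ℕ} (hp : Monotone p) :
    ∏ j, ∏ i ∈ Finset.Iio j, (q ^ p j - q ^ p i) =
      (∏ j : Fin N, ∏ _i ∈ Finset.Iio j, (-1 : ℝ)) * (∏ i : Fin N, q ^ (p i * (i.rev : ℕ))) *
        ∏ j, ∏ i ∈ Finset.Iio j, (1 - q ^ (p j - p i)) := by
  have hrev : ∏ i : Fin N, q ^ (p i * (i.rev : ℕ)) = ∏ j, ∏ i ∈ Finset.Iio j, q ^ p i := by
    rw [Finset.prod_comm' (t' := Finset.univ) (s' := fun i => Finset.Ioi i) (by simp)]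
    refine Finset.prod_congr rfl fun i _ => ?_
    rw [Finset.prod_const, Fin.card_Ioi, pow_mul, Fin.val_rev, Nat.sub_sub, add_comm 1]
  rw [hrev]
  simp only [← Finset.prod_mul_distrib]
  refine Finset.prod_congr rfl fun j _ => Finset.prod_congr rfl fun i hi => ?_
  rw [← Nat.add_sub_cancel' (hp (Finset.mem_Iio.1 hi).le), pow_add, Nat.add_sub_cancel_left]
  ring

theorem prod_pow_shiftedRows {N : ℕ} {lam : YoungDiagram} (hN : lam.colLen 0 ≤ N) (c : ℝ) :
    ∏ j, c ^ shiftedRows N lam j = (∏ j : Fin N, c ^ (j : ℕ)) * c ^ lam.card := by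
  rw [card_eq_sum_rowLen hN, Finset.sum_range, ← Equiv.sum_comp Fin.revPerm,
    ← Finset.prod_pow_eq_pow_sum, ← Finset.prod_mul_distrib]
  refine Finset.prod_congr rfl fun j _ => ?_
  rw [shiftedRows, pow_add, mul_comm, Fin.revPerm_apply]

theorem prod_pow_shiftedRows_mul_rev {N : ℕ} {lam : YoungDiagram} (hN : lam.colLen 0 ≤ N) (q : ℝ) :
    ∏ i, q ^ (shiftedRows N lam i * (i.rev : ℕ)) =
      (∏ i : Fin N, q ^ ((i : ℕ) * (i.rev : ℕ))) * q ^ bStat lam := by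
  rw [bStat_eq_sum hN, Finset.sum_range, ← Equiv.sum_comp Fin.revPerm,
    ← Finset.prod_pow_eq_pow_sum, ← Finset.prod_mul_distrib]
  refine Finset.prod_congr rfl fun j _ => ?_
  rw [← pow_add, shiftedRows, Fin.revPerm_apply]
  ring

theorem prod_one_sub_hook (q : ℝ) {N : ℕ} {lam : YoungDiagram} (hN : lam.colLen 0 ≤ N) :
    (∏ c ∈ lam.cells, (1 - q ^ hook lam c)) *
        ∏ j : Fin N, ∏ i ∈ Finset.Iio j, (1 - q ^ (shiftedRows N lam j - shiftedRows N lam i)) =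
      ∏ j : Fin N, qPoch q q (shiftedRows N lam j) := by
  simp only [qPoch_self]
  exact prod_hook hN fun k => 1 - q ^ k

theorem prod_one_sub_pow_sub_bot (q : ℝ) (N : ℕ) :
    ∏ j : Fin N, ∏ i ∈ Finset.Iio j, (1 - q ^ ((j : ℕ) - i)) = ∏ j : Fin N, qPoch q q j := by
  have h := prod_one_sub_hook q ((colLen_bot 0).trans_le (Nat.zero_le N))
  simpa only [shiftedRows_bot, YoungDiagram.cells_bot, Finset.prod_empty, one_mul] using h

theorem alternant_shiftedRows (c q : ℝ) {N : ℕ} {lam : YoungDiagram} (hN : lam.colLen 0 ≤ N) :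
    alternant (geomParam c q N) (shiftedRows N lam) *
        (∏ x ∈ lam.cells, (1 - q ^ hook lam x)) * ∏ j : Fin N, qPoch q q j =
      alternant (geomParam c q N) (fun j => j) * c ^ lam.card * q ^ bStat lam *
        ∏ j : Fin N, qPoch q q (shiftedRows N lam j) := by
  rw [alternant_geomParam, alternant_geomParam,
    prod_pow_sub_pow q (strictMono_shiftedRows N lam).monotone,
    prod_pow_sub_pow q Fin.val_strictMono.monotone, ← prod_one_sub_hook q hN,
    ← prod_one_sub_pow_sub_bot, prod_pow_shiftedRows hN, prod_pow_shiftedRows_mul_rev hN]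
  ring

theorem rawWeight_eq_sq {ξ c q : ℝ} (hc : c ^ 2 = ξ ^ 2 * q) (lam : YoungDiagram) :
    rawWeight ξ q lam =
      (c ^ lam.card * q ^ bStat lam / ∏ x ∈ lam.cells, (1 - q ^ hook lam x)) ^ 2 := by
  rw [rawWeight, ← hc, Finset.prod_div_distrib, Finset.prod_const_one, Finset.prod_pow, div_pow,
    mul_pow, ← pow_mul, ← pow_mul, ← pow_mul]
  ring

theorem alternant_sq_shiftedRows {ξ c q : ℝ} (hc : c ^ 2 = ξ ^ 2 * q) (hq : 0 < q) (hq1 : q < 1)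
    {N : ℕ} {lam : YoungDiagram} (hN : lam.colLen 0 ≤ N) :
    alternant (geomParam c q N) (shiftedRows N lam) ^ 2 =
      alternant (geomParam c q N) (fun j => j) ^ 2 * (rawWeight ξ q lam * rowRatio q N lam) := by
  have hhook : (∏ x ∈ lam.cells, (1 - q ^ hook lam x)) ≠ 0 := Finset.prod_ne_zero_iff.2 fun x hx =>
    (sub_pos.2 (pow_lt_one₀ hq.le hq1 (hook_pos hx).ne')).ne'
  have hpoch : (∏ j : Fin N, qPoch q q j) ≠ 0 := Finset.prod_ne_zero_iff.2 fun j _ =>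
    (qPoch_self_pos hq hq1 j).ne'
  rw [rawWeight_eq_sq hc, rowRatio, Finset.prod_pow, Finset.prod_div_distrib, ← mul_pow, ← mul_pow]
  congr 1
  field_simp
  linear_combination alternant_shiftedRows c q hN

/-! ### Euler's expansion of the infinite `q`-shifted factorial -/

theorem differentiable_tsum_mul_pow {a : ℕ → ℝ} (ha : ∀ t : ℝ, Summable fun i => a i * t ^ i) :
    Differentiable ℝ fun t : ℝ => ∑' i, a i * t ^ i := by
  let p : FormalMultilinearSeries ℝ ℝ ℝ := .ofScalars ℝ a
  have hp : p.radius = ⊤ := p.radius_eq_top_of_summable_norm fun r => by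
    simpa only [p, FormalMultilinearSeries.ofScalars_norm, norm_mul, norm_pow, NNReal.norm_eq]
      using (ha r).norm
  have hball := p.hasFPowerSeriesOnBall (hp ▸ ENNReal.zero_lt_top)
  rw [hp] at hball
  have hsum : p.sum = fun t : ℝ => ∑' i, a i * t ^ i := by
    funext t
    exact FormalMultilinearSeries.ofScalars_sum_eq a t
  rw [← hsum]
  simpa only [Metric.eball_top, differentiableOn_univ] using hball.differentiableOn

theorem multipliable_one_sub_mul_pow {q : ℝ} (hq : 0 < q) (hq1 : q < 1) (x : ℝ) :
    Multipliable fun k : ℕ => 1 - x * q ^ k := by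
  simp only [sub_eq_add_neg]
  exact multipliable_one_add_of_summable
    ((summable_geometric_of_lt_one hq.le hq1).mul_left x).neg.norm

theorem tendsto_qPoch {q : ℝ} (hq : 0 < q) (hq1 : q < 1) (x : ℝ) :
    Tendsto (qPoch x q) atTop (𝓝 (qPochInf x q)) :=
  (multipliable_one_sub_mul_pow hq hq1 x).hasProd.tendsto_prod_nat

theorem qPoch_self_succ (q : ℝ) (n : ℕ) :
    qPoch q q (n + 1) = qPoch q q n * (1 - q ^ (n + 1)) := by
  rw [qPoch, Finset.prod_range_succ, ← pow_succ', qPoch]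

theorem qPochInf_eq_mul {q : ℝ} (hq : 0 < q) (hq1 : q < 1) (x : ℝ) :
    qPochInf x q = (1 - x) * qPochInf (x * q) q := by
  have hterm (k : ℕ) : 1 - x * q ^ (k + 1) = 1 - x * q * q ^ k := by ring
  have h := Multipliable.prod_mul_tprod_nat_mul' (f := fun k : ℕ => 1 - x * q ^ k) (k := 1) (by
    simpa only [hterm] using multipliable_one_sub_mul_pow hq hq1 (x * q))
  simpa only [qPochInf, hterm, Finset.prod_range_one, pow_zero, mul_one] using h.symm

theorem antitone_qPoch_self {q : ℝ} (hq : 0 < q) (hq1 : q < 1) : Antitone (qPoch q q) := by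
  refine antitone_nat_of_succ_le fun n => ?_
  rw [qPoch_self_succ]
  exact mul_le_of_le_one_right (qPoch_self_pos hq hq1 n).le
    (sub_le_self 1 (pow_nonneg hq.le (n + 1)))

theorem qPochInf_self_le {q : ℝ} (hq : 0 < q) (hq1 : q < 1) (n : ℕ) :
    qPochInf q q ≤ qPoch q q n :=
  (antitone_qPoch_self hq hq1).le_of_tendsto (tendsto_qPoch hq hq1 q) n

theorem qPochInf_self_pos {q : ℝ} (hq : 0 < q) (hq1 : q < 1) : 0 < qPochInf q q := by
  refine lt_of_le_of_ne
    (ge_of_tendsto' (tendsto_qPoch hq hq1 q) fun n => (qPoch_self_pos hq hq1 n).le) (Ne.symm ?_)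
  have h := tprod_one_add_ne_zero_of_summable (f := fun k : ℕ => -(q * q ^ k)) (fun k => ?_)
    ((summable_geometric_of_lt_one hq.le hq1).mul_left q).neg.norm
  · simpa only [← sub_eq_add_neg, qPochInf] using h
  · rw [← sub_eq_add_neg, ← pow_succ']
    exact (sub_pos.2 (pow_lt_one₀ hq.le hq1 k.succ_ne_zero)).ne'

theorem choose_two_succ (i : ℕ) : (i + 1).choose 2 = i + i.choose 2 := by
  rw [Nat.choose_succ_succ' i 1, Nat.choose_one_right]

theorem summable_pow_choose_two {q : ℝ} (hq : 0 < q) (hq1 : q < 1) (x : ℝ) :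
    Summable fun i : ℕ => q ^ i.choose 2 * x ^ i := by
  rcases eq_or_ne x 0 with rfl | hx
  · refine summable_of_ne_finset_zero (s := {0}) fun i hi => ?_
    rw [zero_pow (mt Finset.mem_singleton.2 hi), mul_zero]
  refine summable_of_ratio_test_tendsto_lt_one (l := 0) one_pos
    (Eventually.of_forall fun i => mul_ne_zero (pow_ne_zero _ hq.ne') (pow_ne_zero _ hx)) ?_
  have hlim : Tendsto (fun i : ℕ => ‖q ^ i * x‖) atTop (𝓝 0) := by
    simpa only [zero_mul, norm_zero] using
      ((tendsto_pow_atTop_nhds_zero_of_lt_one hq.le hq1).mul_const x).norm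
  refine hlim.congr fun i => ?_
  have hpow : q ^ i.choose 2 ≠ 0 := pow_ne_zero _ hq.ne'
  rw [← norm_div, choose_two_succ, pow_add, pow_succ x]
  congr 1
  field_simp

theorem summable_mul_pow_of_abs_le {q B : ℝ} (hq : 0 < q) (hq1 : q < 1) {a : ℕ → ℝ}
    (ha : ∀ i, |a i| ≤ B * q ^ i.choose 2) (x : ℝ) : Summable fun i => a i * x ^ i := by
  refine Summable.of_norm_bounded ((summable_pow_choose_two hq hq1 |x|).mul_left B) fun i => ?_
  rw [Real.norm_eq_abs, abs_mul, abs_pow, ← mul_assoc]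
  exact mul_le_mul_of_nonneg_right (ha i) (pow_nonneg (abs_nonneg x) i)

/-- The coefficients of Euler's expansion of `(x; q)_∞` in powers of `x`. -/
def eulerCoeff (q : ℝ) (i : ℕ) : ℝ := (-1) ^ i * q ^ i.choose 2 / qPoch q q i

theorem abs_eulerCoeff_le {q : ℝ} (hq : 0 < q) (hq1 : q < 1) (i : ℕ) :
    |eulerCoeff q i| ≤ (qPochInf q q)⁻¹ * q ^ i.choose 2 := by
  rw [eulerCoeff, abs_div, abs_mul, abs_pow, abs_neg, abs_one, one_pow, one_mul,
    abs_of_pos (pow_pos hq _), abs_of_pos (qPoch_self_pos hq hq1 i), div_eq_inv_mul]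
  exact mul_le_mul_of_nonneg_right (inv_anti₀ (qPochInf_self_pos hq hq1)
    (qPochInf_self_le hq hq1 i)) (pow_nonneg hq.le _)

theorem summable_eulerCoeff {q : ℝ} (hq : 0 < q) (hq1 : q < 1) (x : ℝ) :
    Summable fun i : ℕ => eulerCoeff q i * x ^ i :=
  summable_mul_pow_of_abs_le hq hq1 (abs_eulerCoeff_le hq hq1) x

theorem eulerCoeff_zero (q : ℝ) : eulerCoeff q 0 = 1 := by
  simp only [eulerCoeff, qPoch, pow_zero, Nat.choose_zero_succ, Finset.range_zero,
    Finset.prod_empty, mul_one, div_one]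

theorem eulerCoeff_succ {q : ℝ} (hq : 0 < q) (hq1 : q < 1) (i : ℕ) :
    eulerCoeff q (i + 1) * (1 - q ^ (i + 1)) = -(q ^ i * eulerCoeff q i) := by
  have hpoch := (qPoch_self_pos hq hq1 i).ne'
  have hone : 1 - q ^ (i + 1) ≠ 0 := (sub_pos.2 (pow_lt_one₀ hq.le hq1 i.succ_ne_zero)).ne'
  rw [eulerCoeff, eulerCoeff, qPoch_self_succ, choose_two_succ, pow_add q i]
  field_simp
  ring

theorem tsum_eulerCoeff_eq_mul {q : ℝ} (hq : 0 < q) (hq1 : q < 1) (x : ℝ) :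
    ∑' i, eulerCoeff q i * x ^ i = (1 - x) * ∑' i, eulerCoeff q i * (x * q) ^ i := by
  have hx := summable_eulerCoeff hq hq1 x
  have hxq := summable_eulerCoeff hq hq1 (x * q)
  have hshift : HasSum (fun i => eulerCoeff q (i + 1) * x ^ (i + 1) -
      eulerCoeff q (i + 1) * (x * q) ^ (i + 1)) (-x * ∑' i, eulerCoeff q i * (x * q) ^ i) := by
    refine (hxq.hasSum.mul_left (-x)).congr_fun fun i => ?_
    rw [mul_pow, mul_pow]
    linear_combination (x ^ (i + 1)) * eulerCoeff_succ hq hq1 i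
  have hdiff := (hx.hasSum.sub hxq.hasSum).unique ((hasSum_nat_add_iff' 1).1 (by
    simpa only [Finset.sum_range_one, pow_zero, sub_self, sub_zero] using hshift))
  linear_combination hdiff

theorem tsum_eulerCoeff_eq_qPoch_mul {q : ℝ} (hq : 0 < q) (hq1 : q < 1) (x : ℝ) (n : ℕ) :
    ∑' i, eulerCoeff q i * x ^ i = qPoch x q n * ∑' i, eulerCoeff q i * (x * q ^ n) ^ i := by
  induction n with
  | zero => simp only [qPoch, Finset.range_zero, Finset.prod_empty, pow_zero, mul_one, one_mul]
  | succ n ih =>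
    rw [ih, tsum_eulerCoeff_eq_mul hq hq1 (x * q ^ n), qPoch, qPoch, Finset.prod_range_succ,
      pow_succ, mul_assoc (∏ k ∈ Finset.range n, (1 - x * q ^ k)), mul_assoc x]

theorem qPochInf_eq_tsum {q : ℝ} (hq : 0 < q) (hq1 : q < 1) (x : ℝ) :
    qPochInf x q = ∑' i, eulerCoeff q i * x ^ i := by
  have hzero : ∑' i, eulerCoeff q i * (0 : ℝ) ^ i = 1 := by
    rw [tsum_eq_single 0 fun i hi => by rw [zero_pow hi, mul_zero], eulerCoeff_zero, pow_zero,
      mul_one]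
  have harg : Tendsto (fun n : ℕ => x * q ^ n) atTop (𝓝 0) := by
    simpa only [mul_zero] using (tendsto_pow_atTop_nhds_zero_of_lt_one hq.le hq1).const_mul x
  have hone : Tendsto (fun n : ℕ => ∑' i, eulerCoeff q i * (x * q ^ n) ^ i) atTop (𝓝 1) :=
    hzero ▸ ((differentiable_tsum_mul_pow (summable_eulerCoeff hq hq1)).continuous.tendsto 0).comp
      harg
  have hlim := (tendsto_qPoch hq hq1 x).mul hone
  simp only [← tsum_eulerCoeff_eq_qPoch_mul hq hq1, mul_one] at hlim
  exact tendsto_nhds_unique hlim tendsto_const_nhds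

theorem hasSum_qPochInf {q : ℝ} (hq : 0 < q) (hq1 : q < 1) (x : ℝ) :
    HasSum (fun i : ℕ => eulerCoeff q i * x ^ i) (qPochInf x q) :=
  qPochInf_eq_tsum hq hq1 x ▸ (summable_eulerCoeff hq hq1 x).hasSum

theorem differentiable_qPochInf {q : ℝ} (hq : 0 < q) (hq1 : q < 1) :
    Differentiable ℝ fun x => qPochInf x q := by
  simpa only [qPochInf_eq_tsum hq hq1] using
    differentiable_tsum_mul_pow (summable_eulerCoeff hq hq1)

theorem exists_abs_qPochInf_le {q : ℝ} (hq : 0 < q) (hq1 : q < 1) (s : ℝ) :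
    ∃ B, ∀ i : ℕ, |qPochInf (s * q ^ (i + 1)) q| ≤ B := by
  obtain ⟨B, hB⟩ := (isCompact_Icc (a := -|s|) (b := |s|)).exists_bound_of_continuousOn
    (differentiable_qPochInf hq hq1).continuous.continuousOn
  refine ⟨B, fun i => hB _ (abs_le.1 ?_)⟩
  rw [abs_mul, abs_of_pos (pow_pos hq _)]
  exact mul_le_of_le_one_right (abs_nonneg s) (pow_le_one₀ hq.le hq1.le)

/-! ### The Hahn–Exton function as a power series in `q ^ ν` -/

/-- The coefficients of the expansion `besselSeries` of the Hahn–Exton function in powers of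
`q ^ ν`. -/
def besselCoeff (s q : ℝ) (i : ℕ) : ℝ :=
  qPochInf (s * q ^ (i + 1)) q * ((-1) ^ i * q ^ (i + 1).choose 2) /
    (qPochInf q q * qPoch q q i)

/-- The entire function `t ↦ ∑ g_i t ^ i` of `t = q ^ ν`, with parameter `s = ξ²`, for which
`J_ν(2ξ; q) = ξ ^ ν ∑ g_i q ^ (ν i)`. In contrast to the defining series of the Hahn–Exton function,
its coefficients do not depend on `ν`. -/
def besselSeries (s q t : ℝ) : ℝ := ∑' i, besselCoeff s q i * t ^ i

/-- The terms of a double series, symmetric in `s` and `t`, whose row sums are the terms of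
`besselSeries s q t`. -/
def besselDouble (s t q : ℝ) (i m : ℕ) : ℝ :=
  (qPochInf q q)⁻¹ * (eulerCoeff q i * (q * t) ^ i * (eulerCoeff q m * (q * s) ^ m)) * q ^ (i * m)

theorem besselCoeff_eq {s q : ℝ} (i : ℕ) :
    besselCoeff s q i =
      (qPochInf q q)⁻¹ * (eulerCoeff q i * q ^ i) * qPochInf (s * q ^ (i + 1)) q := by
  rw [besselCoeff, eulerCoeff, choose_two_succ, pow_add, div_eq_mul_inv, div_eq_mul_inv, mul_inv]
  ring

theorem tsum_besselDouble {q : ℝ} (hq : 0 < q) (hq1 : q < 1) (s t : ℝ) (i : ℕ) :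
    ∑' m, besselDouble s t q i m = besselCoeff s q i * t ^ i := by
  have h := (hasSum_qPochInf hq hq1 (s * q ^ (i + 1))).mul_left
    ((qPochInf q q)⁻¹ * (eulerCoeff q i * (q * t) ^ i))
  have hterm (m : ℕ) : (qPochInf q q)⁻¹ * (eulerCoeff q i * (q * t) ^ i) *
      (eulerCoeff q m * (s * q ^ (i + 1)) ^ m) = besselDouble s t q i m := by
    rw [besselDouble, pow_succ, pow_mul]
    ring
  simp only [hterm] at h
  rw [h.tsum_eq, besselCoeff_eq, mul_pow]
  ring

theorem summable_besselDouble {q : ℝ} (hq : 0 < q) (hq1 : q < 1) (s t : ℝ) :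
    Summable (Function.uncurry (besselDouble s t q)) := by
  have hprod := ((summable_eulerCoeff hq hq1 (q * t)).norm.mul_norm
    (summable_eulerCoeff hq hq1 (q * s)).norm).mul_left ‖(qPochInf q q)⁻¹‖
  refine Summable.of_norm_bounded hprod fun ⟨i, m⟩ => ?_
  simp only [Function.uncurry_apply_pair, besselDouble]
  rw [norm_mul, norm_mul (qPochInf q q)⁻¹, norm_pow q, Real.norm_of_nonneg hq.le]
  exact mul_le_of_le_one_right (by positivity) (pow_le_one₀ hq.le hq1.le)

theorem besselSeries_symm {q : ℝ} (hq : 0 < q) (hq1 : q < 1) (s t : ℝ) :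
    besselSeries s q t = besselSeries t q s :=
  calc besselSeries s q t = ∑' i, ∑' m, besselDouble s t q i m := by
        simp only [tsum_besselDouble hq hq1, besselSeries]
    _ = ∑' m, ∑' i, besselDouble s t q i m := (summable_besselDouble hq hq1 s t).tsum_comm.symm
    _ = ∑' m, ∑' i, besselDouble t s q m i := by
        refine tsum_congr fun m => tsum_congr fun i => ?_
        rw [besselDouble, besselDouble, mul_comm i m, mul_comm (eulerCoeff q i * (q * t) ^ i)]
    _ = besselSeries t q s := by simp only [tsum_besselDouble hq hq1, besselSeries]

theorem hahnExton_eq {q : ℝ} (hq : 0 < q) (hq1 : q < 1) (ξ ν : ℝ) :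
    hahnExton ν (2 * ξ) q = ξ ^ ν * besselSeries (ξ ^ 2) q (q ^ ν) := by
  rw [besselSeries_symm hq hq1, besselSeries, hahnExton, mul_div_cancel_left₀ ξ two_ne_zero]
  congr 1
  refine tsum_congr fun m => ?_
  have hpow : q ^ (ν + 1 + m) = q ^ ν * q ^ (m + 1) := by
    rw [← Real.rpow_natCast q (m + 1), ← Real.rpow_add hq, Nat.cast_succ, add_assoc,
      add_comm (1 : ℝ)]
  have harg : q * (2 * ξ) ^ 2 / 4 = q * ξ ^ 2 := by ring
  rw [hpow, harg, besselCoeff, choose_two_succ, pow_add, mul_pow]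
  ring

theorem exists_abs_besselCoeff_le {q : ℝ} (hq : 0 < q) (hq1 : q < 1) (s : ℝ) :
    ∃ B, ∀ i, |besselCoeff s q i| ≤ B * q ^ i.choose 2 := by
  obtain ⟨B, hB⟩ := exists_abs_qPochInf_le hq hq1 s
  have hinv := inv_pos.2 (qPochInf_self_pos hq hq1)
  refine ⟨(qPochInf q q)⁻¹ * (qPochInf q q)⁻¹ * B, fun i => ?_⟩
  have hcoeff : |eulerCoeff q i * q ^ i| ≤ (qPochInf q q)⁻¹ * q ^ i.choose 2 := by
    rw [abs_mul, abs_of_pos (pow_pos hq i)]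
    exact (mul_le_of_le_one_right (abs_nonneg _) (pow_le_one₀ hq.le hq1.le)).trans
      (abs_eulerCoeff_le hq hq1 i)
  calc |besselCoeff s q i|
      = (qPochInf q q)⁻¹ * |eulerCoeff q i * q ^ i| * |qPochInf (s * q ^ (i + 1)) q| := by
        rw [besselCoeff_eq, abs_mul, abs_mul (qPochInf q q)⁻¹, abs_of_pos hinv]
    _ ≤ (qPochInf q q)⁻¹ * ((qPochInf q q)⁻¹ * q ^ i.choose 2) * B := by
        gcongr
        exact hB i
    _ = (qPochInf q q)⁻¹ * (qPochInf q q)⁻¹ * B * q ^ i.choose 2 := by ring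

theorem summable_besselCoeff {q : ℝ} (hq : 0 < q) (hq1 : q < 1) (s t : ℝ) :
    Summable fun i => besselCoeff s q i * t ^ i :=
  (exists_abs_besselCoeff_le hq hq1 s).elim fun _ hB => summable_mul_pow_of_abs_le hq hq1 hB t

theorem differentiable_besselSeries {q : ℝ} (hq : 0 < q) (hq1 : q < 1) (s : ℝ) :
    Differentiable ℝ (besselSeries s q) :=
  differentiable_tsum_mul_pow (summable_besselCoeff hq hq1 s)

theorem besselCoeff_succ {q : ℝ} (hq : 0 < q) (hq1 : q < 1) (s : ℝ) (i : ℕ) :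
    besselCoeff s q (i + 1) * ((1 - q ^ (i + 1)) * (1 - s * q ^ (i + 1))) =
      -(q ^ (i + 1) * besselCoeff s q i) := by
  have hpoch := qPochInf_eq_mul hq hq1 (s * q ^ (i + 1))
  rw [mul_assoc s, ← pow_succ] at hpoch
  rw [besselCoeff_eq, besselCoeff_eq, hpoch]
  linear_combination (qPochInf q q)⁻¹ * q ^ (i + 1) * (1 - s * q ^ (i + 1)) *
    qPochInf (s * q ^ (i + 1 + 1)) q * eulerCoeff_succ hq hq1 i

theorem besselSeries_recurrence {q : ℝ} (hq : 0 < q) (hq1 : q < 1) (s t : ℝ) :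
    besselSeries s q t + s * besselSeries s q (q * (q * t)) =
      (1 - q * t + s) * besselSeries s q (q * t) := by
  have hsum (t : ℝ) : HasSum (fun i => besselCoeff s q i * t ^ i) (besselSeries s q t) :=
    (summable_besselCoeff hq hq1 s t).hasSum
  have hshift : HasSum (fun i => besselCoeff s q (i + 1) *
      ((1 - q ^ (i + 1)) * (1 - s * q ^ (i + 1))) * t ^ (i + 1))
      (-(q * t) * besselSeries s q (q * t)) := by
    refine ((hsum (q * t)).mul_left (-(q * t))).congr_fun fun i => ?_
    rw [besselCoeff_succ hq hq1, mul_pow]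
    ring
  have hall : HasSum (fun i => besselCoeff s q i * ((1 - q ^ i) * (1 - s * q ^ i)) * t ^ i)
      (-(q * t) * besselSeries s q (q * t)) :=
    (hasSum_nat_add_iff' 1).1 (by
      simpa only [Finset.sum_range_one, pow_zero, sub_self, zero_mul, mul_zero, sub_zero] using
        hshift)
  have hcomb : HasSum (fun i => besselCoeff s q i * ((1 - q ^ i) * (1 - s * q ^ i)) * t ^ i)
      (besselSeries s q t + s * besselSeries s q (q * (q * t)) -
        (1 + s) * besselSeries s q (q * t)) := by
    refine (((hsum t).add ((hsum (q * (q * t))).mul_left s)).sub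
      ((hsum (q * t)).mul_left (1 + s))).congr_fun fun i => ?_
    rw [mul_pow, mul_pow]
    ring
  linear_combination hcomb.unique hall

/-! ### The `q`-Bessel kernel as a series -/

/-- The function `ν ↦ q ^ (ν / 2) J_ν(2ξ; q)`. -/
def scaledBessel (ξ q ν : ℝ) : ℝ := (ξ * √q) ^ ν * besselSeries (ξ ^ 2) q (q ^ ν)

/-- The series `∑_l q ^ ((r + u + 1) / 2 + l) J_{r + 1/2 + l} J_{u + 1/2 + l}`, which has no
singularity at `r = u`. -/
def kernelSeries (ξ q r u : ℝ) : ℝ :=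
  ∑' l : ℕ, scaledBessel ξ q (r + 1 / 2 + l) * scaledBessel ξ q (u + 1 / 2 + l)

/-- The discrete Wronskian `ξ (J_ν J_{μ - 1} - J_{ν - 1} J_μ)` of two Hahn–Exton functions, which
is the numerator of the `q`-Bessel kernel. -/
def casoratian (ξ q ν μ : ℝ) : ℝ :=
  ξ * (hahnExton ν (2 * ξ) q * hahnExton (μ - 1) (2 * ξ) q -
    hahnExton (ν - 1) (2 * ξ) q * hahnExton μ (2 * ξ) q)

theorem scaledBessel_eq {ξ q : ℝ} (hξ : 0 < ξ) (hq : 0 < q) (hq1 : q < 1) (ν : ℝ) :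
    scaledBessel ξ q ν = q ^ (ν / 2) * hahnExton ν (2 * ξ) q := by
  rw [scaledBessel, hahnExton_eq hq hq1, Real.mul_rpow hξ.le (Real.sqrt_nonneg q),
    Real.sqrt_eq_rpow, ← Real.rpow_mul hq.le, one_div_mul_eq_div]
  ring

theorem mul_sqrt_pos {ξ q : ℝ} (hξ : 0 < ξ) (hq : 0 < q) : 0 < ξ * √q :=
  mul_pos hξ (Real.sqrt_pos.2 hq)

theorem mul_sqrt_sq {q : ℝ} (hq : 0 < q) (ξ : ℝ) : (ξ * √q) ^ 2 = ξ ^ 2 * q := by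
  rw [mul_pow, Real.sq_sqrt hq.le]

theorem mul_sqrt_lt_one {ξ q : ℝ} (hq : 0 < q) (hξq : ξ ^ 2 * q < 1) : ξ * √q < 1 :=
  lt_of_pow_lt_pow_left₀ 2 zero_le_one (by rwa [mul_sqrt_sq hq, one_pow])

theorem continuous_scaledBessel {ξ q : ℝ} (hξ : 0 < ξ) (hq : 0 < q) (hq1 : q < 1) :
    Continuous (scaledBessel ξ q) :=
  (Real.continuous_const_rpow (mul_sqrt_pos hξ hq).ne').mul
    ((differentiable_besselSeries hq hq1 (ξ ^ 2)).continuous.comp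
      (Real.continuous_const_rpow hq.ne'))

theorem exists_abs_scaledBessel_le {ξ q : ℝ} (hξ : 0 < ξ) (hq : 0 < q) (hq1 : q < 1)
    (hξq : ξ ^ 2 * q < 1) (ν₀ : ℝ) :
    ∃ B, 0 ≤ B ∧ ∀ ν, ν₀ ≤ ν → ∀ l : ℕ, |scaledBessel ξ q (ν + l)| ≤ B * (ξ * √q) ^ l := by
  have hc := mul_sqrt_pos hξ hq
  obtain ⟨B, hB⟩ := (isCompact_Icc (a := 0) (b := q ^ ν₀)).exists_bound_of_continuousOn
    (differentiable_besselSeries hq hq1 (ξ ^ 2)).continuous.continuousOn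
  have hB0 : 0 ≤ B :=
    (norm_nonneg _).trans (hB 0 (Set.left_mem_Icc.2 (Real.rpow_pos_of_pos hq ν₀).le))
  refine ⟨(ξ * √q) ^ ν₀ * B, by positivity, fun ν hν l => ?_⟩
  have hseries : |besselSeries (ξ ^ 2) q (q ^ (ν + l))| ≤ B :=
    hB _ ⟨(Real.rpow_pos_of_pos hq _).le, Real.rpow_le_rpow_of_exponent_ge hq hq1.le
      (hν.trans (le_add_of_nonneg_right (Nat.cast_nonneg l)))⟩
  have hpow : (ξ * √q) ^ ν ≤ (ξ * √q) ^ ν₀ :=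
    Real.rpow_le_rpow_of_exponent_ge hc (mul_sqrt_lt_one hq hξq).le hν
  rw [scaledBessel, abs_mul, abs_of_pos (Real.rpow_pos_of_pos hc _), Real.rpow_add hc,
    Real.rpow_natCast]
  calc (ξ * √q) ^ ν * (ξ * √q) ^ l * |besselSeries (ξ ^ 2) q (q ^ (ν + l))|
      ≤ (ξ * √q) ^ ν₀ * (ξ * √q) ^ l * B := by gcongr
    _ = (ξ * √q) ^ ν₀ * B * (ξ * √q) ^ l := by ring

theorem summable_mul_pow_mul_pow {c : ℝ} (hc : 0 < c) (hc1 : c < 1) (B B' : ℝ) :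
    Summable fun l : ℕ => B * c ^ l * (B' * c ^ l) := by
  refine ((summable_geometric_of_lt_one (mul_pos hc hc).le
    (mul_lt_one_of_nonneg_of_lt_one_left hc.le hc1 hc1.le)).mul_left (B * B')).congr fun l => ?_
  rw [mul_pow]
  ring

theorem summable_scaledBessel_mul {ξ q : ℝ} (hξ : 0 < ξ) (hq : 0 < q) (hq1 : q < 1)
    (hξq : ξ ^ 2 * q < 1) (ν μ : ℝ) :
    Summable fun l : ℕ => scaledBessel ξ q (ν + l) * scaledBessel ξ q (μ + l) := by
  have hc := mul_sqrt_pos hξ hq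
  obtain ⟨B, hB0, hB⟩ := exists_abs_scaledBessel_le hξ hq hq1 hξq ν
  obtain ⟨B', -, hB'⟩ := exists_abs_scaledBessel_le hξ hq hq1 hξq μ
  refine Summable.of_norm_bounded
    (summable_mul_pow_mul_pow hc (mul_sqrt_lt_one hq hξq) B B') fun l => ?_
  rw [norm_mul]
  exact mul_le_mul (hB ν le_rfl l) (hB' μ le_rfl l) (norm_nonneg _) (by positivity)

theorem hahnExton_recurrence {ξ q : ℝ} (hξ : 0 < ξ) (hq : 0 < q) (hq1 : q < 1) (ν : ℝ) :
    ξ * (hahnExton (ν - 1) (2 * ξ) q + hahnExton (ν + 1) (2 * ξ) q) =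
      (1 - q ^ ν + ξ ^ 2) * hahnExton ν (2 * ξ) q := by
  have hrec := besselSeries_recurrence hq hq1 (ξ ^ 2) (q ^ (ν - 1))
  have hq_sub : q * q ^ (ν - 1) = q ^ ν := by
    rw [Real.rpow_sub_one hq.ne', mul_div_cancel₀ _ hq.ne']
  have hq_add : q * q ^ ν = q ^ (ν + 1) := by rw [Real.rpow_add_one hq.ne', mul_comm]
  have hξ_sub : ξ * (ξ ^ ν / ξ) = ξ ^ ν := mul_div_cancel₀ _ hξ.ne'
  rw [hq_sub, hq_add] at hrec
  rw [hahnExton_eq hq hq1, hahnExton_eq hq hq1, hahnExton_eq hq hq1, Real.rpow_add_one hξ.ne',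
    Real.rpow_sub_one hξ.ne']
  linear_combination ξ ^ ν * hrec + besselSeries (ξ ^ 2) q (q ^ (ν - 1)) * hξ_sub

theorem casoratian_sub_casoratian_add_one {ξ q : ℝ} (hξ : 0 < ξ) (hq : 0 < q) (hq1 : q < 1)
    (ν μ : ℝ) :
    casoratian ξ q ν μ - casoratian ξ q (ν + 1) (μ + 1) =
      (q ^ ν - q ^ μ) * (hahnExton ν (2 * ξ) q * hahnExton μ (2 * ξ) q) := by
  rw [casoratian, casoratian, add_sub_cancel_right, add_sub_cancel_right]
  linear_combination hahnExton ν (2 * ξ) q * hahnExton_recurrence hξ hq hq1 μ -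
    hahnExton μ (2 * ξ) q * hahnExton_recurrence hξ hq hq1 ν

theorem rpow_sub_rpow_mul_scaledBessel {ξ q : ℝ} (hξ : 0 < ξ) (hq : 0 < q) (hq1 : q < 1)
    (ν μ : ℝ) :
    (q ^ ((ν - μ) / 2) - q ^ (-((ν - μ) / 2))) * (scaledBessel ξ q ν * scaledBessel ξ q μ) =
      (q ^ ν - q ^ μ) * (hahnExton ν (2 * ξ) q * hahnExton μ (2 * ξ) q) := by
  have hν : q ^ ((ν - μ) / 2) * (q ^ (ν / 2) * q ^ (μ / 2)) = q ^ ν := by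
    rw [← Real.rpow_add hq, ← Real.rpow_add hq]
    ring_nf
  have hμ : q ^ (-((ν - μ) / 2)) * (q ^ (ν / 2) * q ^ (μ / 2)) = q ^ μ := by
    rw [← Real.rpow_add hq, ← Real.rpow_add hq]
    ring_nf
  rw [scaledBessel_eq hξ hq hq1, scaledBessel_eq hξ hq hq1, ← hν, ← hμ]
  ring

theorem tendsto_pow_mul_of_differentiableAt_zero {f : ℝ → ℝ} (hf : DifferentiableAt ℝ f 0)
    (hf0 : f 0 = 0) {x q : ℝ} (hq : |q| < 1) (hxq : |x * q| < 1) :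
    Tendsto (fun l : ℕ => x ^ l * f (q ^ l)) atTop (𝓝 0) := by
  have hlin : (fun l : ℕ => f (q ^ l)) =O[atTop] fun l => q ^ l := by
    simpa only [hf0, sub_zero, Function.comp_def] using
      hf.isBigO_sub.comp_tendsto (tendsto_pow_atTop_nhds_zero_of_abs_lt_one hq)
  refine ((Asymptotics.isBigO_refl (fun l : ℕ => x ^ l) atTop).mul hlin).trans_tendsto ?_
  simpa only [mul_pow] using tendsto_pow_atTop_nhds_zero_of_abs_lt_one hxq

theorem tendsto_casoratian_add_natCast {ξ q : ℝ} (hξ : 0 < ξ) (hq : 0 < q) (hq1 : q < 1)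
    (hξq : ξ ^ 2 * q < 1) (ν μ : ℝ) :
    Tendsto (fun l : ℕ => casoratian ξ q (ν + l) (μ + l)) atTop (𝓝 0) := by
  set g := besselSeries (ξ ^ 2) q
  let f : ℝ → ℝ := fun t =>
    g (q ^ ν * t) * g (q ^ (μ - 1) * t) - g (q ^ (ν - 1) * t) * g (q ^ μ * t)
  have hgd : Differentiable ℝ g := differentiable_besselSeries hq hq1 (ξ ^ 2)
  have hf : Differentiable ℝ f := by fun_prop
  have hf0 : f 0 = 0 := by simp only [f, mul_zero, sub_self]
  have hlim := tendsto_pow_mul_of_differentiableAt_zero (hf 0) hf0 (abs_lt.2 ⟨by linarith, hq1⟩)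
    (abs_lt.2 ⟨by linarith [mul_pos (pow_pos hξ 2) hq], hξq⟩)
  have hJ (κ : ℝ) (l : ℕ) :
      hahnExton (κ + l) (2 * ξ) q = ξ ^ κ * ξ ^ l * g (q ^ κ * q ^ l) := by
    rw [hahnExton_eq hq hq1, Real.rpow_add hξ, Real.rpow_add hq, Real.rpow_natCast,
      Real.rpow_natCast]
  have hξ_sub (κ : ℝ) : ξ * ξ ^ (κ - 1) = ξ ^ κ := by
    rw [Real.rpow_sub_one hξ.ne', mul_div_cancel₀ _ hξ.ne']
  rw [← mul_zero (ξ ^ ν * ξ ^ μ)]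
  refine (hlim.const_mul (ξ ^ ν * ξ ^ μ)).congr fun l => ?_
  rw [casoratian, add_sub_right_comm, add_sub_right_comm, hJ, hJ, hJ, hJ, ← hξ_sub ν, ← hξ_sub μ]
  simp only [f]
  ring

theorem hasSum_scaledBessel_mul {ξ q : ℝ} (hξ : 0 < ξ) (hq : 0 < q) (hq1 : q < 1)
    (hξq : ξ ^ 2 * q < 1) (ν μ : ℝ) :
    HasSum (fun l : ℕ => (q ^ ((ν - μ) / 2) - q ^ (-((ν - μ) / 2))) *
      (scaledBessel ξ q (ν + l) * scaledBessel ξ q (μ + l))) (casoratian ξ q ν μ) := by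
  have hstep (l : ℕ) : (q ^ ((ν - μ) / 2) - q ^ (-((ν - μ) / 2))) *
      (scaledBessel ξ q (ν + l) * scaledBessel ξ q (μ + l)) =
      casoratian ξ q (ν + l) (μ + l) - casoratian ξ q (ν + (l + 1 : ℕ)) (μ + (l + 1 : ℕ)) := by
    rw [Nat.cast_succ, ← add_assoc, ← add_assoc, casoratian_sub_casoratian_add_one hξ hq hq1,
      ← rpow_sub_rpow_mul_scaledBessel hξ hq hq1, add_sub_add_right_eq_sub]
  have hsum := ((summable_scaledBessel_mul hξ hq hq1 hξq ν μ).mul_left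
    (q ^ ((ν - μ) / 2) - q ^ (-((ν - μ) / 2)))).hasSum
  have hlim := (tendsto_casoratian_add_natCast hξ hq hq1 hξq ν μ).const_sub (casoratian ξ q ν μ)
  rw [sub_zero] at hlim
  refine (tendsto_nhds_unique hsum.tendsto_sum_nat (hlim.congr fun n => ?_)) ▸ hsum
  simp only [hstep]
  rw [Finset.sum_range_sub' fun l : ℕ => casoratian ξ q (ν + l) (μ + l), Nat.cast_zero, add_zero,
    add_zero]

theorem kernelQuotient_eq_kernelSeries {ξ q : ℝ} (hξ : 0 < ξ) (hq : 0 < q) (hq1 : q < 1)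
    (hξq : ξ ^ 2 * q < 1) {r u : ℝ} (hru : r ≠ u) :
    kernelQuotient ξ q r u = kernelSeries ξ q r u := by
  have hden : q ^ ((r - u) / 2) - q ^ (-((r - u) / 2)) ≠ 0 := fun h => by
    have hexp := (Real.rpow_right_inj hq hq1.ne).1 (sub_eq_zero.1 h)
    exact hru (by linarith)
  have hsum := (hasSum_scaledBessel_mul hξ hq hq1 hξq (r + 1 / 2) (u + 1 / 2)).tsum_eq
  rw [tsum_mul_left, add_sub_add_right_eq_sub, casoratian, add_sub_assoc, add_sub_assoc] at hsum
  rw [kernelQuotient, kernelSeries, div_eq_iff hden, mul_comm (tsum _), hsum]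
  norm_num [sub_eq_add_neg]

theorem tendsto_kernelSeries {ξ q : ℝ} (hξ : 0 < ξ) (hq : 0 < q) (hq1 : q < 1)
    (hξq : ξ ^ 2 * q < 1) (r : ℝ) :
    Tendsto (fun u => kernelSeries ξ q r u) (𝓝 r) (𝓝 (kernelSeries ξ q r r)) := by
  have hc := mul_sqrt_pos hξ hq
  obtain ⟨B, hB0, hB⟩ := exists_abs_scaledBessel_le hξ hq hq1 hξq (r - 1 / 2)
  refine tendsto_tsum_of_dominated_convergence
    (summable_mul_pow_mul_pow hc (mul_sqrt_lt_one hq hξq) B B) (fun l => ?_) ?_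
  · exact (((continuous_scaledBessel hξ hq hq1).comp
      (by fun_prop : Continuous fun u : ℝ => u + 1 / 2 + (l : ℝ))).tendsto r).const_mul _
  · filter_upwards [Metric.ball_mem_nhds r one_pos] with u hu l
    rw [Metric.mem_ball, Real.dist_eq, abs_lt] at hu
    rw [norm_mul]
    exact mul_le_mul (hB _ (by linarith) l) (hB _ (by linarith) l) (norm_nonneg _) (by positivity)

theorem tendsto_kernelQuotient {ξ q : ℝ} (hξ : 0 < ξ) (hq : 0 < q) (hq1 : q < 1)
    (hξq : ξ ^ 2 * q < 1) (r : ℝ) :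
    Tendsto (fun u => kernelQuotient ξ q r u) (𝓝[≠] r) (𝓝 (kernelSeries ξ q r r)) := by
  refine ((tendsto_kernelSeries hξ hq hq1 hξq r).mono_left nhdsWithin_le_nhds).congr' ?_
  filter_upwards [self_mem_nhdsWithin] with u hu
  exact (kernelQuotient_eq_kernelSeries hξ hq hq1 hξq (Ne.symm hu)).symm

theorem qBesselKernel_eq_kernelSeries {ξ q : ℝ} (hξ : 0 < ξ) (hq : 0 < q) (hq1 : q < 1)
    (hξq : ξ ^ 2 * q < 1) (r u : ℝ) : qBesselKernel ξ q r u = kernelSeries ξ q r u := by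
  rw [qBesselKernel]
  split_ifs with h
  · exact h ▸ (tendsto_kernelQuotient hξ hq hq1 hξq r).limUnder_eq
  · exact kernelQuotient_eq_kernelSeries hξ hq hq1 hξq h

/-! ### The kernel of the ensemble with `N` rows -/

theorem hasSum_ensembleKernel_pow {N : ℕ} {a : Fin N → ℝ} (ha : ∀ i j, |a i * a j| < 1)
    (x y : ℕ) :
    HasSum (fun l : ℕ => (∑ i, cauchyCoeff a i * a i ^ (x + l)) *
        ∑ j, cauchyCoeff a j * a j ^ (y + l))
      (ensembleKernel (fun i x => a i ^ x) (cauchyInverse a) x y) := by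
  have hgeom : HasSum (fun l : ℕ => ∑ i, ∑ j, a i ^ x * cauchyCoeff a i *
      (a i * a j) ^ l * (cauchyCoeff a j * a j ^ y))
      (∑ i, ∑ j, a i ^ x * cauchyCoeff a i * (1 - a i * a j)⁻¹ * (cauchyCoeff a j * a j ^ y)) :=
    hasSum_sum fun i _ => hasSum_sum fun j _ =>
      ((hasSum_geometric_of_abs_lt_one (ha i j)).mul_left _).mul_right _
  have hkernel : ensembleKernel (fun i x => a i ^ x) (cauchyInverse a) x y =
      ∑ i, ∑ j, a i ^ x * cauchyCoeff a i * (1 - a i * a j)⁻¹ * (cauchyCoeff a j * a j ^ y) :=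
    Finset.sum_congr rfl fun i _ => Finset.sum_congr rfl fun j _ => by
      rw [cauchyInverse_apply]
      ring
  rw [hkernel]
  refine hgeom.congr_fun fun l => ?_
  rw [Finset.sum_mul_sum]
  refine Finset.sum_congr rfl fun i _ => Finset.sum_congr rfl fun j _ => ?_
  rw [mul_pow, pow_add, pow_add]
  ring

theorem geomParam_pos {c q : ℝ} (hc : 0 < c) (hq : 0 < q) {N : ℕ} (i : Fin N) :
    0 < geomParam c q N i :=
  mul_pos hc (pow_pos hq i)

theorem geomParam_lt_one {c q : ℝ} (hc : 0 < c) (hc1 : c < 1) (hq : 0 < q) (hq1 : q < 1) {N : ℕ}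
    (i : Fin N) : geomParam c q N i < 1 :=
  (mul_le_of_le_one_right hc.le (pow_le_one₀ hq.le hq1.le)).trans_lt hc1

theorem geomParam_injective {c q : ℝ} (hc : 0 < c) (hq : 0 < q) (hq1 : q < 1) (N : ℕ) :
    Function.Injective (geomParam c q N) := fun _ _ h =>
  Fin.ext (pow_right_injective₀ hq hq1.ne (mul_left_cancel₀ hc.ne' h))

theorem geomParam_mul_lt_one {c q : ℝ} (hc : 0 < c) (hc1 : c < 1) (hq : 0 < q) (hq1 : q < 1)
    {N : ℕ} (i j : Fin N) : geomParam c q N i * geomParam c q N j < 1 :=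
  mul_lt_one_of_nonneg_of_lt_one_left (geomParam_pos hc hq i).le
    (geomParam_lt_one hc hc1 hq hq1 i) (geomParam_lt_one hc hc1 hq hq1 j).le

theorem abs_geomParam_mul_lt_one {c q : ℝ} (hc : 0 < c) (hc1 : c < 1) (hq : 0 < q) (hq1 : q < 1)
    {N : ℕ} (i j : Fin N) : |geomParam c q N i * geomParam c q N j| < 1 := by
  rw [abs_of_pos (mul_pos (geomParam_pos hc hq i) (geomParam_pos hc hq j))]
  exact geomParam_mul_lt_one hc hc1 hq hq1 i j

theorem prod_erase_fin {M : Type*} [CommMonoid M] {N : ℕ} (i : Fin N) (f : ℕ → M) :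
    ∏ j ∈ Finset.univ.erase i, f j =
      (∏ j ∈ Finset.range i, f j) * ∏ k ∈ Finset.range (N - 1 - i), f (i + 1 + k) := by
  have hite : ∏ j ∈ Finset.univ.erase i, f j = ∏ j : Fin N, if (j : ℕ) = i then 1 else f j := by
    rw [← Finset.prod_erase Finset.univ (a := i) (by simp)]
    refine Finset.prod_congr rfl fun j hj => ?_
    rw [if_neg fun h => Finset.ne_of_mem_erase hj (Fin.ext h)]
  have hN : N = i + 1 + (N - 1 - i) := by omega
  rw [hite, ← Finset.prod_range (fun j => if j = (i : ℕ) then 1 else f j), congrArg Finset.range hN,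
    Finset.prod_range_add, Finset.prod_range_succ, if_pos rfl, mul_one]
  congr 1
  · exact Finset.prod_congr rfl fun j hj => if_neg (Finset.mem_range.1 hj).ne
  · exact Finset.prod_congr rfl fun j _ => if_neg (by omega)

theorem prod_range_pow_sub_pow (q : ℝ) (n : ℕ) :
    ∏ j ∈ Finset.range n, (q ^ n - q ^ j) = (-1) ^ n * q ^ n.choose 2 * qPoch q q n := by
  have hterm : ∀ j ∈ Finset.range n, q ^ n - q ^ j = -1 * q ^ j * (1 - q * q ^ (n - 1 - j)) := by
    intro j hj
    have hn : n = j + (n - 1 - j + 1) := by have := Finset.mem_range.1 hj; omega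
    rw [congrArg (q ^ ·) hn]
    ring
  have hsum : ∑ j ∈ Finset.range n, j = n.choose 2 := by
    rw [Finset.sum_range_id, Nat.choose_two_right]
  rw [Finset.prod_congr rfl hterm, Finset.prod_mul_distrib, Finset.prod_mul_distrib,
    Finset.prod_const, Finset.card_range, Finset.prod_pow_eq_pow_sum, hsum,
    Finset.prod_range_reflect (fun k => 1 - q * q ^ k) n, qPoch]

theorem prod_range_pow_sub_pow_add (q : ℝ) (i m : ℕ) :
    ∏ k ∈ Finset.range m, (q ^ i - q ^ (i + 1 + k)) = (q ^ i) ^ m * qPoch q q m := by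
  rw [qPoch, ← Finset.card_range m, ← Finset.prod_const, Finset.card_range,
    ← Finset.prod_mul_distrib]
  exact Finset.prod_congr rfl fun k _ => by ring

theorem mul_self_eq_choose_two (i : ℕ) : i * i = i.choose 2 + (i.choose 2 + i) := by
  induction i with
  | zero => rfl
  | succ i ih => rw [choose_two_succ]; linarith

theorem prod_erase_geomParam_sub_mul {c q : ℝ} (hq : 0 < q) (hq1 : q < 1) {N : ℕ} (i : Fin N) :
    (∏ j ∈ Finset.univ.erase i, (geomParam c q N i - geomParam c q N j)) *
        (eulerCoeff q i * q ^ (i : ℕ)) =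
      geomParam c q N i ^ (N - 1) * qPoch q q (N - 1 - i) := by
  have hpoch := (qPoch_self_pos hq hq1 i).ne'
  have hprod : ∏ j ∈ Finset.univ.erase i, (geomParam c q N i - geomParam c q N j) =
      c ^ (N - 1) * ∏ j ∈ Finset.univ.erase i, (q ^ (i : ℕ) - q ^ (j : ℕ)) := by
    simp only [geomParam, ← mul_sub]
    rw [Finset.prod_mul_distrib, Finset.prod_const,
      Finset.card_erase_of_mem (Finset.mem_univ i), Finset.card_fin]
  have hpow : (q ^ (i : ℕ)) ^ (N - 1) =
      q ^ (i : ℕ).choose 2 * (q ^ (i : ℕ).choose 2 * q ^ (i : ℕ)) *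
        (q ^ (i : ℕ)) ^ (N - 1 - i) := by
    rw [← pow_add q, ← pow_add q, ← mul_self_eq_choose_two, pow_mul, ← pow_add]
    congr 1
    omega
  have hsign : ((-1 : ℝ) ^ (i : ℕ)) * (-1) ^ (i : ℕ) = 1 := by
    rw [← mul_pow, neg_one_mul, neg_neg, one_pow]
  rw [hprod, prod_erase_fin i fun j => q ^ (i : ℕ) - q ^ j, prod_range_pow_sub_pow,
    prod_range_pow_sub_pow_add, eulerCoeff, geomParam, mul_pow, hpow]
  field_simp
  linear_combination (c ^ (N - 1) * qPoch q q (N - 1 - i)) * hsign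

/-- The analogue of `besselCoeff` for the ensemble with `N` rows, which has only `N` nonzero
coefficients. -/
def finiteCoeff (s q : ℝ) (N i : ℕ) : ℝ :=
  if i < N then
    (qPoch q q (N - 1 - i))⁻¹ * (eulerCoeff q i * q ^ i) * qPoch (s * q ^ (i + 1)) q N
  else 0

/-- The analogue of `besselSeries` for the ensemble with `N` rows. -/
def finiteSeries (s q : ℝ) (N : ℕ) (t : ℝ) : ℝ := ∑' i, finiteCoeff s q N i * t ^ i

/-- The correlation kernel of the ensemble with `N` rows, as the analogue of `kernelSeries`. The
integers `x` and `y` stand for the points `x + 1 / 2` and `y + 1 / 2`. -/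
def finiteKernel (c s q : ℝ) (N : ℕ) (x y : ℤ) : ℝ :=
  ∑' l : ℕ, (c ^ (x + 1 + l) * finiteSeries s q N (q ^ (x + 1 + l))) *
    (c ^ (y + 1 + l) * finiteSeries s q N (q ^ (y + 1 + l)))

theorem geomParam_mul {c s q : ℝ} (hcs : c ^ 2 = s * q) {N : ℕ} (i j : Fin N) :
    geomParam c q N i * geomParam c q N j = s * q ^ ((i : ℕ) + 1) * q ^ (j : ℕ) := by
  rw [geomParam, geomParam]
  linear_combination q ^ (i : ℕ) * q ^ (j : ℕ) * hcs

theorem cauchyCoeff_geomParam_mul_pow {c s q : ℝ} (hc : 0 < c) (hq : 0 < q) (hq1 : q < 1)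
    (hcs : c ^ 2 = s * q) {N : ℕ} (i : Fin N) :
    cauchyCoeff (geomParam c q N) i * geomParam c q N i ^ (N - 1) = finiteCoeff s q N i := by
  have hdiff : ∏ j ∈ Finset.univ.erase i, (geomParam c q N i - geomParam c q N j) ≠ 0 :=
    Finset.prod_ne_zero_iff.2 fun j hj => sub_ne_zero.2
      ((geomParam_injective hc hq hq1 N).ne (Finset.ne_of_mem_erase hj).symm)
  have hpoch := (qPoch_self_pos hq hq1 (N - 1 - i)).ne'
  have hnum : ∏ j, (1 - geomParam c q N i * geomParam c q N j) =
      qPoch (s * q ^ ((i : ℕ) + 1)) q N := by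
    rw [qPoch, Finset.prod_range]
    exact Finset.prod_congr rfl fun j _ => by rw [geomParam_mul hcs]
  rw [finiteCoeff, if_pos i.isLt, cauchyCoeff, hnum]
  field_simp
  linear_combination -qPoch (s * q ^ ((i : ℕ) + 1)) q N *
    prod_erase_geomParam_sub_mul (c := c) hq hq1 i

theorem sum_cauchyCoeff_geomParam_mul_pow {c s q : ℝ} (hc : 0 < c) (hq : 0 < q) (hq1 : q < 1)
    (hcs : c ^ 2 = s * q) {N x : ℕ} {n : ℤ} (hx : (x : ℤ) = n + (N - 1)) :
    ∑ i, cauchyCoeff (geomParam c q N) i * geomParam c q N i ^ x =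
      c ^ n * finiteSeries s q N (q ^ n) := by
  rw [finiteSeries, tsum_eq_sum (s := Finset.range N) fun i hi => by
    rw [finiteCoeff, if_neg (mt Finset.mem_range.2 hi), zero_mul], Finset.sum_range,
    Finset.mul_sum]
  refine Finset.sum_congr rfl fun i _ => ?_
  have hpow : geomParam c q N i ^ x = geomParam c q N i ^ n * geomParam c q N i ^ (N - 1) := by
    rw [← zpow_natCast, ← zpow_natCast, ← zpow_add₀ (geomParam_pos hc hq i).ne',
      Nat.cast_pred i.pos, hx]
  have hzpow : geomParam c q N i ^ n = c ^ n * (q ^ n) ^ (i : ℕ) := by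
    rw [geomParam, mul_zpow, ← zpow_natCast, ← zpow_natCast, ← zpow_mul, ← zpow_mul, mul_comm n]
  rw [hpow, hzpow, ← cauchyCoeff_geomParam_mul_pow hc hq hq1 hcs]
  ring

theorem ensembleKernel_geomParam {c s q : ℝ} (hc : 0 < c) (hc1 : c < 1) (hq : 0 < q) (hq1 : q < 1)
    (hcs : c ^ 2 = s * q) {N x y : ℕ} {m n : ℤ} (hx : (x : ℤ) = m + N) (hy : (y : ℤ) = n + N) :
    ensembleKernel (fun i x => geomParam c q N i ^ x) (cauchyInverse (geomParam c q N)) x y =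
      finiteKernel c s q N m n := by
  rw [← (hasSum_ensembleKernel_pow (abs_geomParam_mul_lt_one hc hc1 hq hq1) x y).tsum_eq,
    finiteKernel]
  refine tsum_congr fun l => ?_
  rw [sum_cauchyCoeff_geomParam_mul_pow hc hq hq1 hcs (n := m + 1 + l) (by push_cast; omega),
    sum_cauchyCoeff_geomParam_mul_pow hc hq hq1 hcs (n := n + 1 + l) (by push_cast; omega)]

theorem qPoch_mem_Icc {x q : ℝ} (hq : 0 < q) (hq1 : q < 1) (hx : x ∈ Set.Icc 0 1) (n : ℕ) :
    qPoch x q n ∈ Set.Icc 0 1 := by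
  have hle (k : ℕ) : x * q ^ k ≤ 1 := mul_le_one₀ hx.2 (pow_pos hq k).le (pow_le_one₀ hq.le hq1.le)
  exact ⟨Finset.prod_nonneg fun k _ => sub_nonneg.2 (hle k), Finset.prod_le_one
    (fun k _ => sub_nonneg.2 (hle k)) fun k _ => sub_le_self 1 (mul_nonneg hx.1 (pow_pos hq k).le)⟩

theorem abs_finiteCoeff_le {s q : ℝ} (hq : 0 < q) (hq1 : q < 1) (hs : 0 ≤ s) (hsq : s * q ≤ 1)
    (N i : ℕ) : |finiteCoeff s q N i| ≤ (qPochInf q q)⁻¹ ^ 2 * q ^ i.choose 2 := by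
  have hinf := qPochInf_self_pos hq hq1
  have hpoch := qPoch_self_pos hq hq1 (N - 1 - i)
  rw [finiteCoeff]
  split_ifs
  · have hx : s * q ^ (i + 1) ∈ Set.Icc 0 1 := by
      refine ⟨by positivity, ?_⟩
      rw [pow_succ', ← mul_assoc]
      exact mul_le_one₀ hsq (pow_pos hq i).le (pow_le_one₀ hq.le hq1.le)
    obtain ⟨hN0, hN1⟩ := qPoch_mem_Icc hq hq1 hx N
    calc |(qPoch q q (N - 1 - i))⁻¹ * (eulerCoeff q i * q ^ i) * qPoch (s * q ^ (i + 1)) q N|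
        = (qPoch q q (N - 1 - i))⁻¹ * (|eulerCoeff q i| * q ^ i) * qPoch (s * q ^ (i + 1)) q N := by
          rw [abs_mul, abs_mul, abs_mul, abs_of_pos (inv_pos.2 hpoch), abs_of_pos (pow_pos hq i),
            abs_of_nonneg hN0]
      _ ≤ (qPochInf q q)⁻¹ * ((qPochInf q q)⁻¹ * q ^ i.choose 2 * 1) * 1 := by
          gcongr
          · exact qPochInf_self_le hq hq1 _
          · exact abs_eulerCoeff_le hq hq1 i
          · exact pow_le_one₀ hq.le hq1.le
      _ = (qPochInf q q)⁻¹ ^ 2 * q ^ i.choose 2 := by ring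
  · rw [abs_zero]
    positivity

theorem tendsto_nat_sub_sub_atTop (k i : ℕ) : Tendsto (fun N : ℕ => N - k - i) atTop atTop :=
  (tendsto_sub_atTop_nat i).comp (tendsto_sub_atTop_nat k)

theorem tendsto_finiteCoeff {q : ℝ} (hq : 0 < q) (hq1 : q < 1) (s : ℝ) (i : ℕ) :
    Tendsto (fun N => finiteCoeff s q N i) atTop (𝓝 (besselCoeff s q i)) := by
  have hpoch := (tendsto_qPoch hq hq1 q).comp (tendsto_nat_sub_sub_atTop 1 i)
  rw [besselCoeff_eq]
  refine (((hpoch.inv₀ (qPochInf_self_pos hq hq1).ne').mul_const (eulerCoeff q i * q ^ i)).mul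
    (tendsto_qPoch hq hq1 (s * q ^ (i + 1)))).congr' ?_
  filter_upwards [eventually_gt_atTop i] with N hN
  rw [finiteCoeff, if_pos hN, Function.comp_apply]

theorem tendsto_finiteSeries {s q : ℝ} (hq : 0 < q) (hq1 : q < 1) (hs : 0 ≤ s) (hsq : s * q ≤ 1)
    (t : ℝ) : Tendsto (fun N => finiteSeries s q N t) atTop (𝓝 (besselSeries s q t)) := by
  refine tendsto_tsum_of_dominated_convergence
    ((summable_pow_choose_two hq hq1 |t|).mul_left ((qPochInf q q)⁻¹ ^ 2))
    (fun i => (tendsto_finiteCoeff hq hq1 s i).mul_const _) (Eventually.of_forall fun N i => ?_)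
  rw [Real.norm_eq_abs, abs_mul, abs_pow, ← mul_assoc]
  exact mul_le_mul_of_nonneg_right (abs_finiteCoeff_le hq hq1 hs hsq N i) (by positivity)

theorem exists_abs_finiteSeries_le {s q : ℝ} (hq : 0 < q) (hq1 : q < 1) (hs : 0 ≤ s)
    (hsq : s * q ≤ 1) (T : ℝ) : ∃ B, ∀ N t, |t| ≤ T → |finiteSeries s q N t| ≤ B := by
  refine ⟨_, fun N t ht => tsum_of_norm_bounded (E := ℝ)
    ((summable_pow_choose_two hq hq1 T).mul_left ((qPochInf q q)⁻¹ ^ 2)).hasSum fun i => ?_⟩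
  rw [Real.norm_eq_abs, abs_mul, abs_pow, ← mul_assoc]
  exact mul_le_mul (abs_finiteCoeff_le hq hq1 hs hsq N i)
    (pow_le_pow_left₀ (abs_nonneg t) ht i) (by positivity) (by positivity)

theorem exists_abs_zpow_mul_finiteSeries_le {c s q : ℝ} (hc : 0 < c) (hq : 0 < q) (hq1 : q < 1)
    (hs : 0 ≤ s) (hsq : s * q ≤ 1) (x : ℤ) : ∃ B, 0 ≤ B ∧ ∀ N l : ℕ,
      |c ^ (x + l) * finiteSeries s q N (q ^ (x + l))| ≤ B * c ^ l := by
  obtain ⟨B, hB⟩ := exists_abs_finiteSeries_le hq hq1 hs hsq (q ^ x)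
  have hB0 : 0 ≤ B := (abs_nonneg _).trans (hB 0 (q ^ x) (abs_of_pos (zpow_pos hq x)).le)
  refine ⟨c ^ x * B, by positivity, fun N l => ?_⟩
  have ht : |q ^ (x + l)| ≤ q ^ x := by
    rw [abs_of_pos (zpow_pos hq _), zpow_add₀ hq.ne', zpow_natCast]
    exact mul_le_of_le_one_right (zpow_pos hq _).le (pow_le_one₀ hq.le hq1.le)
  rw [abs_mul, abs_of_pos (zpow_pos hc _), zpow_add₀ hc.ne', zpow_natCast, mul_right_comm _ B]
  exact mul_le_mul_of_nonneg_left (hB N _ ht) (by positivity)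

theorem tendsto_finiteKernel {ξ q : ℝ} (hξ : 0 < ξ) (hq : 0 < q) (hq1 : q < 1)
    (hξq : ξ ^ 2 * q < 1) (x y : ℤ) :
    Tendsto (fun N => finiteKernel (ξ * √q) (ξ ^ 2) q N x y) atTop
      (𝓝 (kernelSeries ξ q (x + 1 / 2) (y + 1 / 2))) := by
  have hc := mul_sqrt_pos hξ hq
  have hterm (x : ℤ) (l : ℕ) : Tendsto
      (fun N => (ξ * √q) ^ (x + 1 + l) * finiteSeries (ξ ^ 2) q N (q ^ (x + 1 + l))) atTop
      (𝓝 (scaledBessel ξ q ((x : ℝ) + 1 / 2 + 1 / 2 + l))) := by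
    have hν : (x : ℝ) + 1 / 2 + 1 / 2 + l = ((x + 1 + l : ℤ) : ℝ) := by push_cast; ring
    rw [hν, scaledBessel, Real.rpow_intCast, Real.rpow_intCast]
    exact (tendsto_finiteSeries hq hq1 (sq_nonneg ξ) hξq.le _).const_mul _
  obtain ⟨B, hB0, hB⟩ := exists_abs_zpow_mul_finiteSeries_le hc hq hq1 (sq_nonneg ξ) hξq.le (x + 1)
  obtain ⟨B', -, hB'⟩ := exists_abs_zpow_mul_finiteSeries_le hc hq hq1 (sq_nonneg ξ) hξq.le (y + 1)
  refine tendsto_tsum_of_dominated_convergence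
    (summable_mul_pow_mul_pow hc (mul_sqrt_lt_one hq hξq) B B')
    (fun l => (hterm x l).mul (hterm y l)) (Eventually.of_forall fun N l => ?_)
  rw [norm_mul]
  exact mul_le_mul (hB N l) (hB' N l) (norm_nonneg _) (by positivity)

/-! ### The normalization -/

theorem prod_prod_erase_sub_sq {N : ℕ} (a : Fin N → ℝ) :
    (∏ i, ∏ j ∈ Finset.univ.erase i, (a i - a j)) ^ 2 =
      (alternant a (fun j => j) ^ 2) ^ 2 := by
  have hvandermonde : alternant a (fun j => j) = ∏ i, ∏ j ∈ Finset.Ioi i, (a j - a i) :=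
    Matrix.det_vandermonde a
  have hsplit (i : Fin N) : ∏ j ∈ Finset.univ.erase i, (a i - a j) =
      (∏ j ∈ Finset.Iio i, (a i - a j)) * ∏ j ∈ Finset.Ioi i, (a i - a j) := by
    rw [← Finset.prod_union (Finset.disjoint_left.2 fun j hj hj' =>
      lt_asymm (Finset.mem_Iio.1 hj) (Finset.mem_Ioi.1 hj'))]
    refine Finset.prod_congr (Finset.ext fun j => ?_) fun _ _ => rfl
    simp [lt_or_lt_iff_ne]
  have hbelow : ∏ i, ∏ j ∈ Finset.Iio i, (a i - a j) = alternant a (fun j => j) :=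
    (Finset.prod_comm' (by simp)).trans hvandermonde.symm
  have habove : (∏ i, ∏ j ∈ Finset.Ioi i, (a i - a j)) ^ 2 = alternant a (fun j => j) ^ 2 := by
    simp only [hvandermonde, ← Finset.prod_pow, sub_sq_comm]
  simp only [hsplit]
  rw [Finset.prod_mul_distrib, hbelow, mul_pow, habove, ← sq]

theorem alternant_ne_zero {N : ℕ} {a : Fin N → ℝ} (ha : Function.Injective a) :
    alternant a (fun j => j) ≠ 0 :=
  Matrix.det_vandermonde_ne_zero_iff.2 ha

theorem det_cauchyMatrix_sq {N : ℕ} {a : Fin N → ℝ} (ha : Function.Injective a)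
    (h0 : ∀ i, a i ≠ 0) (h1 : ∀ i j, 1 - a i * a j ≠ 0) :
    Matrix.det (cauchyMatrix a) ^ 2 =
      (alternant a (fun j => j) ^ 2 * (∏ i, ∏ j, (1 - a i * a j))⁻¹) ^ 2 := by
  have hsq := prod_prod_erase_sub_sq a
  have hinv := congrArg Matrix.det (cauchyMatrix_mul_cauchyInverse ha h0 h1)
  rw [cauchyInverse, Matrix.det_mul, Matrix.det_mul, Matrix.det_mul, Matrix.det_diagonal,
    Matrix.det_one] at hinv
  simp only [cauchyCoeff, Finset.prod_mul_distrib, Finset.prod_inv_distrib] at hinv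
  set D := ∏ i, ∏ j ∈ Finset.univ.erase i, (a i - a j)
  have hD : D ≠ 0 := Finset.prod_ne_zero_iff.2 fun i _ => Finset.prod_ne_zero_iff.2 fun j hj =>
    sub_ne_zero.2 (ha.ne (Finset.ne_of_mem_erase hj).symm)
  have hP : ∏ i, ∏ j, (1 - a i * a j) ≠ 0 := Finset.prod_ne_zero_iff.2 fun i _ =>
    Finset.prod_ne_zero_iff.2 fun j _ => h1 i j
  rw [mul_pow, ← hsq]
  field_simp at hinv ⊢
  linear_combination hinv

theorem hasSum_pow_mul_pow {N : ℕ} {a : Fin N → ℝ} (h : ∀ i j, |a i * a j| < 1) (i j : Fin N) :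
    HasSum (fun x : ℕ => a i ^ x * a j ^ x) (cauchyMatrix a i j) := by
  simpa only [mul_pow, cauchyMatrix, Matrix.of_apply] using hasSum_geometric_of_abs_lt_one (h i j)

theorem det_cauchyMatrix {N : ℕ} {a : Fin N → ℝ} (ha : Function.Injective a)
    (h0 : ∀ i, a i ≠ 0) (h1 : ∀ i j, |a i * a j| < 1) :
    Matrix.det (cauchyMatrix a) =
      alternant a (fun j => j) ^ 2 * (∏ i, ∏ j, (1 - a i * a j))⁻¹ := by
  have hpos (i j : Fin N) : 0 < 1 - a i * a j := sub_pos.2 (abs_lt.1 (h1 i j)).2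
  have hdet : 0 ≤ Matrix.det (cauchyMatrix a) := by
    have h := hasSum_prod_mul_ensembleWeight (fun i x => a i ^ x) (u := fun _ => 1)
      (fun _ => zero_le_one) (G := cauchyMatrix a)
      fun i j => by simpa only [one_mul] using hasSum_pow_mul_pow h1 i j
    simp only [Finset.prod_const_one, one_mul] at h
    exact h.nonneg (ensembleWeight_nonneg _)
  have hprod : 0 ≤ (∏ i, ∏ j, (1 - a i * a j))⁻¹ := inv_nonneg.2 <|
    Finset.prod_nonneg fun i _ => Finset.prod_nonneg fun j _ => (hpos i j).le
  exact (pow_left_inj₀ hdet (mul_nonneg (sq_nonneg _) hprod) two_ne_zero).1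
    (det_cauchyMatrix_sq ha h0 fun i j => (hpos i j).ne')

/-- The MacMahon product for partitions with at most `N` rows; `s` stands for `ξ²`. -/
def finiteMacMahon (s q : ℝ) (N : ℕ) : ℝ :=
  ∏ i ∈ Finset.range N, ∏ j ∈ Finset.range N, (1 - s * q ^ (i + j + 1))⁻¹

theorem det_cauchyMatrix_geomParam {c s q : ℝ} (hc : 0 < c) (hc1 : c < 1) (hq : 0 < q)
    (hq1 : q < 1) (hcs : c ^ 2 = s * q) (N : ℕ) :
    Matrix.det (cauchyMatrix (geomParam c q N)) =
      alternant (geomParam c q N) (fun j => j) ^ 2 * finiteMacMahon s q N := by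
  rw [det_cauchyMatrix (geomParam_injective hc hq hq1 N) (fun i => (geomParam_pos hc hq i).ne')
    (abs_geomParam_mul_lt_one hc hc1 hq hq1), finiteMacMahon, Finset.prod_range]
  simp only [Finset.prod_range, ← Finset.prod_inv_distrib, geomParam_mul hcs]
  congr! 4 with i _ j
  ring

theorem multipliable_inv_one_sub {ι : Type*} {f : ι → ℝ} {r : ℝ} (hf : Summable f)
    (hf0 : ∀ i, 0 ≤ f i) (hr : r < 1) (hfr : ∀ i, f i ≤ r) :
    Multipliable fun i => (1 - f i)⁻¹ := by
  have hpos (i : ι) : 0 < 1 - f i := sub_pos.2 ((hfr i).trans_lt hr)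
  have hsum : Summable fun i => f i * (1 - f i)⁻¹ := by
    refine Summable.of_nonneg_of_le (fun i => mul_nonneg (hf0 i) (inv_pos.2 (hpos i)).le)
      (fun i => ?_) (hf.mul_right (1 - r)⁻¹)
    exact mul_le_mul_of_nonneg_left
      (inv_anti₀ (sub_pos.2 hr) (sub_le_sub_left (hfr i) 1)) (hf0 i)
  refine (Real.multipliable_one_add_of_summable hsum).congr fun i => ?_
  have := (hpos i).ne'
  field_simp
  ring

theorem hasProd_macMahon {ξ q : ℝ} (hq : 0 < q) (hq1 : q < 1) (hξq : ξ ^ 2 * q < 1) :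
    HasProd (fun p : ℕ × ℕ => (1 - ξ ^ 2 * q ^ (p.1 + p.2 + 1))⁻¹) (macMahon ξ q) := by
  have hgeom := summable_geometric_of_lt_one hq.le hq1
  have hsum : Summable fun p : ℕ × ℕ => ξ ^ 2 * q ^ (p.1 + p.2 + 1) := by
    refine ((hgeom.mul_of_nonneg hgeom (fun n => (pow_pos hq n).le)
      fun n => (pow_pos hq n).le).mul_left (ξ ^ 2 * q)).congr fun p => ?_
    ring
  have hle (p : ℕ × ℕ) : ξ ^ 2 * q ^ (p.1 + p.2 + 1) ≤ ξ ^ 2 * q :=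
    mul_le_mul_of_nonneg_left (pow_le_of_le_one hq.le hq1.le (Nat.succ_ne_zero _)) (sq_nonneg ξ)
  have h := (multipliable_inv_one_sub hsum (fun p => by positivity) hξq hle).hasProd
  have hdiag := ((Finset.HasAntidiagonal.sigmaAntidiagonalEquivProd (A := ℕ)).hasProd_iff.2
    h).sigma fun n => hasProd_fintype _
  convert h
  refine Eq.trans (tprod_congr fun n => ?_) hdiag.tprod_eq
  have hcell (p : Finset.HasAntidiagonal.antidiagonal n) :
      (1 - ξ ^ 2 * q ^ ((p : ℕ × ℕ).1 + (p : ℕ × ℕ).2 + 1))⁻¹ =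
        (1 - ξ ^ 2 * q ^ (n + 1))⁻¹ := by
    rw [Finset.HasAntidiagonal.mem_antidiagonal.1 p.2]
  simp only [Function.comp_apply, Finset.HasAntidiagonal.sigmaAntidiagonalEquivProd_apply, hcell,
    Finset.prod_const, Finset.card_univ, Fintype.card_coe, Finset.Nat.card_antidiagonal, one_div,
    inv_pow]

theorem tendsto_finiteMacMahon {ξ q : ℝ} (hq : 0 < q) (hq1 : q < 1) (hξq : ξ ^ 2 * q < 1) :
    Tendsto (finiteMacMahon (ξ ^ 2) q) atTop (𝓝 (macMahon ξ q)) := by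
  have hsquare : Tendsto (fun N => Finset.range N ×ˢ Finset.range N) atTop atTop := by
    refine tendsto_finsetProd_atTop.comp (g := fun p => p.1 ×ˢ p.2)
      (f := fun N => (Finset.range N, Finset.range N)) ?_
    rw [← prod_atTop_atTop_eq]
    exact tendsto_finset_range.prodMk tendsto_finset_range
  exact ((hasProd_macMahon hq hq1 hξq).comp hsquare).congr fun N => Finset.prod_product _ _ _

/-! ### Convergence of the ensembles with `N` rows -/

open Classical in
/-- The weight of a partition in the ensemble with `N` rows, normalized so that it tends to
`rawWeight` as `N → ∞`. -/
def truncatedWeight (ξ q : ℝ) (N : ℕ) (lam : YoungDiagram) : ℝ :=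
  if lam.colLen 0 ≤ N then rawWeight ξ q lam * rowRatio q N lam else 0

theorem rawWeight_nonneg (ξ : ℝ) {q : ℝ} (hq : 0 < q) (lam : YoungDiagram) :
    0 ≤ rawWeight ξ q lam :=
  mul_nonneg (by positivity) (Finset.prod_nonneg fun x _ => by positivity)

theorem rowRatio_nonneg (q : ℝ) (N : ℕ) (lam : YoungDiagram) : 0 ≤ rowRatio q N lam :=
  Finset.prod_nonneg fun _ _ => sq_nonneg _

theorem rowRatio_le_one {q : ℝ} (hq : 0 < q) (hq1 : q < 1) (N : ℕ) (lam : YoungDiagram) :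
    rowRatio q N lam ≤ 1 := by
  refine Finset.prod_le_one (fun j _ => sq_nonneg _) fun j _ => ?_
  have hden := qPoch_self_pos hq hq1 j
  refine pow_le_one₀ (div_nonneg (qPoch_self_pos hq hq1 _).le hden.le) ((div_le_one hden).2 ?_)
  exact antitone_qPoch_self hq hq1 (Nat.le_add_left _ _)

theorem rowRatio_eq_prod_range {q : ℝ} (hq : 0 < q) (hq1 : q < 1) {N : ℕ} {lam : YoungDiagram}
    (hN : lam.colLen 0 ≤ N) :
    rowRatio q N lam = ∏ i ∈ Finset.range (lam.colLen 0),
      (qPoch q q (lam.rowLen i + (N - 1 - i)) / qPoch q q (N - 1 - i)) ^ 2 := by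
  have hrev : rowRatio q N lam = ∏ i ∈ Finset.range N,
      (qPoch q q (lam.rowLen i + (N - 1 - i)) / qPoch q q (N - 1 - i)) ^ 2 := by
    rw [Finset.prod_range, ← Equiv.prod_comp Fin.revPerm, rowRatio]
    refine Finset.prod_congr rfl fun j _ => ?_
    have hj : N - 1 - (Fin.rev j : ℕ) = j := by simp only [Fin.val_rev]; omega
    rw [Fin.revPerm_apply, hj, shiftedRows]
  rw [hrev]
  refine (Finset.prod_subset (Finset.range_mono hN) fun i _ hi => ?_).symm
  rw [rowLen_eq_zero (not_lt.1 (mt Finset.mem_range.2 hi)), zero_add,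
    div_self (qPoch_self_pos hq hq1 _).ne', one_pow]

theorem tendsto_rowRatio {q : ℝ} (hq : 0 < q) (hq1 : q < 1) (lam : YoungDiagram) :
    Tendsto (fun N => rowRatio q N lam) atTop (𝓝 1) := by
  have hQ := (qPochInf_self_pos hq hq1).ne'
  have hden (i : ℕ) : Tendsto (fun N => qPoch q q (N - 1 - i)) atTop (𝓝 (qPochInf q q)) :=
    (tendsto_qPoch hq hq1 q).comp (tendsto_nat_sub_sub_atTop 1 i)
  have hnum (i : ℕ) : Tendsto (fun N => qPoch q q (lam.rowLen i + (N - 1 - i))) atTop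
      (𝓝 (qPochInf q q)) :=
    (tendsto_qPoch hq hq1 q).comp
      (tendsto_atTop_mono (fun N => Nat.le_add_left _ _) (tendsto_nat_sub_sub_atTop 1 i))
  have hprod := tendsto_finsetProd (Finset.range (lam.colLen 0)) fun i _ =>
    ((hnum i).div (hden i) hQ).pow 2
  simp only [div_self hQ, one_pow, Finset.prod_const_one] at hprod
  refine hprod.congr' ?_
  filter_upwards [eventually_ge_atTop (lam.colLen 0)] with N hN
  exact (rowRatio_eq_prod_range hq hq1 hN).symm

theorem truncatedWeight_nonneg (ξ : ℝ) {q : ℝ} (hq : 0 < q) (N : ℕ) (lam : YoungDiagram) :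
    0 ≤ truncatedWeight ξ q N lam :=
  ite_nonneg (mul_nonneg (rawWeight_nonneg ξ hq lam) (rowRatio_nonneg q N lam)) le_rfl

theorem truncatedWeight_le_rawWeight (ξ : ℝ) {q : ℝ} (hq : 0 < q) (hq1 : q < 1) (N : ℕ)
    (lam : YoungDiagram) : truncatedWeight ξ q N lam ≤ rawWeight ξ q lam := by
  rw [truncatedWeight]
  split_ifs
  · exact mul_le_of_le_one_right (rawWeight_nonneg ξ hq lam) (rowRatio_le_one hq hq1 N lam)
  · exact rawWeight_nonneg ξ hq lam

theorem tendsto_truncatedWeight (ξ : ℝ) {q : ℝ} (hq : 0 < q) (hq1 : q < 1) (lam : YoungDiagram) :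
    Tendsto (fun N => truncatedWeight ξ q N lam) atTop (𝓝 (rawWeight ξ q lam)) := by
  have h := (tendsto_rowRatio hq hq1 lam).const_mul (rawWeight ξ q lam)
  rw [mul_one] at h
  refine h.congr' ?_
  filter_upwards [eventually_ge_atTop (lam.colLen 0)] with N hN
  rw [truncatedWeight, if_pos hN]

theorem mem_config_iff {N x : ℕ} {z : ℤ} (hx : (x : ℤ) = z + N) {lam : YoungDiagram}
    (hN : lam.colLen 0 ≤ N) :
    (z : ℝ) + 1 / 2 ∈ config lam ↔ x ∈ Set.range (shiftedRows N lam) := by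
  have hconfig : (z : ℝ) + 1 / 2 ∈ config lam ↔ ∃ r : ℕ, z = lam.rowLen r - (r + 1) := by
    refine exists_congr fun r => ?_
    rw [add_left_inj]
    exact_mod_cast Iff.rfl
  rw [hconfig]
  constructor
  · rintro ⟨r, hr⟩
    have hrN : r < N := by
      by_contra hcon
      have := rowLen_eq_zero (hN.trans (not_lt.1 hcon))
      omega
    refine ⟨Fin.rev ⟨r, hrN⟩, ?_⟩
    simp only [shiftedRows, Fin.rev_rev, Fin.val_rev]
    omega
  · rintro ⟨j, rfl⟩
    refine ⟨j.rev, ?_⟩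
    have hj := Fin.val_rev j
    rw [shiftedRows] at hx
    omega

theorem range_subset_config_iff {N k : ℕ} {z : Fin k → ℤ} {x : Fin k → ℕ}
    (hx : ∀ i, (x i : ℤ) = z i + N) {lam : YoungDiagram} (hN : lam.colLen 0 ≤ N) :
    Set.range (fun i => (z i : ℝ) + 1 / 2) ⊆ config lam ↔
      Set.range x ⊆ Set.range (shiftedRows N lam) := by
  rw [Set.range_subset_iff, Set.range_subset_iff]
  exact forall_congr' fun i => mem_config_iff (hx i) hN

theorem hasSum_indicator_truncatedWeight {ξ q : ℝ} (hξ : 0 < ξ) (hq : 0 < q) (hq1 : q < 1)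
    (hξq : ξ ^ 2 * q < 1) {N k : ℕ} {z : Fin k → ℤ} (hz : Function.Injective z)
    (hzN : ∀ i, 0 ≤ z i + N) :
    HasSum ({lam | Set.range (fun i => (z i : ℝ) + 1 / 2) ⊆ config lam}.indicator
        (truncatedWeight ξ q N))
      (finiteMacMahon (ξ ^ 2) q N * Matrix.det (Matrix.of fun i j : Fin k =>
        finiteKernel (ξ * √q) (ξ ^ 2) q N (z i) (z j))) := by
  classical
  have hc := mul_sqrt_pos hξ hq
  have hc1 := mul_sqrt_lt_one hq hξq
  have hcs := mul_sqrt_sq hq ξ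
  set c := ξ * √q
  set V := alternant (geomParam c q N) (fun j => j)
  have hV : V ≠ 0 := alternant_ne_zero (geomParam_injective hc hq hq1 N)
  have hlt := abs_geomParam_mul_lt_one hc hc1 hq hq1 (N := N)
  lift (fun i => z i + N : Fin k → ℤ) to Fin k → ℕ using hzN with x hx
  replace hx (i : Fin k) : (x i : ℤ) = z i + N := congrFun hx i
  have hxinj : Function.Injective x := fun i j hij => hz <| by
    have := hx i
    have := hx j
    omega
  have h := (hasSum_ensembleWeight_of_range_subset (hasSum_pow_mul_pow hlt)
    (cauchyMatrix_mul_cauchyInverse (geomParam_injective hc hq hq1 N)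
      (fun i => (geomParam_pos hc hq i).ne')
      fun i j => (sub_pos.2 (geomParam_mul_lt_one hc hc1 hq hq1 i j)).ne') hxinj).mul_left
    (V ^ 2)⁻¹
  simp only [ensembleKernel_geomParam hc hc1 hq hq1 hcs (hx _) (hx _)] at h
  rw [det_cauchyMatrix_geomParam hc hc1 hq hq1 hcs, ← mul_assoc,
    inv_mul_cancel_left₀ (pow_ne_zero 2 hV)] at h
  refine hasSum_youngDiagram (fun lam hl => ?_) (fun p hp => ?_) (fun lam hl => ?_) h
  · rw [Set.indicator_apply, truncatedWeight, if_neg hl, ite_self]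
  · rw [ensembleWeight, if_neg hp, ite_self, mul_zero]
  · have hsq := alternant_sq_shiftedRows hcs hq hq1 hl
    change (Matrix.of fun i j => geomParam c q N i ^ shiftedRows N lam j).det ^ 2 = V ^ 2 * _ at hsq
    simp only [Set.indicator_apply, Set.mem_ofPred_eq, range_subset_config_iff hx hl,
      truncatedWeight, if_pos hl, mul_ite, mul_zero, ensembleWeight,
      if_pos (strictMono_shiftedRows N lam), hsq, inv_mul_cancel_left₀ (pow_ne_zero 2 hV)]

theorem summable_rawWeight {ξ q : ℝ} (hξ : 0 < ξ) (hq : 0 < q) (hq1 : q < 1)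
    (hξq : ξ ^ 2 * q < 1) : Summable (rawWeight ξ q) := by
  refine summable_of_sum_le (rawWeight_nonneg ξ hq) (c := macMahon ξ q) fun T => ?_
  refine le_of_tendsto_of_tendsto'
    (tendsto_finsetSum T fun lam _ => tendsto_truncatedWeight ξ hq hq1 lam)
    (tendsto_finiteMacMahon hq hq1 hξq) fun N => ?_
  have h := hasSum_indicator_truncatedWeight hξ hq hq1 hξq (N := N)
    (Function.injective_of_subsingleton Fin.elim0) (fun i => i.elim0)
  simp only [Set.range_eq_empty, Set.empty_subset, Set.ofPred_true, Set.indicator_univ,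
    Matrix.det_isEmpty, mul_one] at h
  exact sum_le_hasSum T (fun lam _ => truncatedWeight_nonneg ξ hq N lam) h

theorem tendsto_det_finiteKernel {ξ q : ℝ} (hξ : 0 < ξ) (hq : 0 < q) (hq1 : q < 1)
    (hξq : ξ ^ 2 * q < 1) {k : ℕ} (z : Fin k → ℤ) :
    Tendsto (fun N => Matrix.det (Matrix.of fun i j : Fin k =>
        finiteKernel (ξ * √q) (ξ ^ 2) q N (z i) (z j))) atTop
      (𝓝 (Matrix.det (Matrix.of fun i j : Fin k =>
        qBesselKernel ξ q (z i + 1 / 2) (z j + 1 / 2)))) := by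
  have hcont : Continuous fun M : Matrix (Fin k) (Fin k) ℝ => M.det := continuous_id.matrix_det
  refine (hcont.tendsto _).comp (tendsto_pi_nhds.2 fun i => tendsto_pi_nhds.2 fun j => ?_)
  simp only [Matrix.of_apply, qBesselKernel_eq_kernelSeries hξ hq hq1 hξq]
  exact tendsto_finiteKernel hξ hq hq1 hξq (z i) (z j)

theorem hasSum_indicator_rawWeight {ξ q : ℝ} (hξ : 0 < ξ) (hq : 0 < q) (hq1 : q < 1)
    (hξq : ξ ^ 2 * q < 1) {k : ℕ} {z : Fin k → ℤ} (hz : Function.Injective z) :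
    HasSum ({lam | Set.range (fun i => (z i : ℝ) + 1 / 2) ⊆ config lam}.indicator
        (rawWeight ξ q))
      (macMahon ξ q * Matrix.det (Matrix.of fun i j : Fin k =>
        qBesselKernel ξ q (z i + 1 / 2) (z j + 1 / 2))) := by
  have hsum := summable_rawWeight hξ hq hq1 hξq
  set S := {lam | Set.range (fun i => (z i : ℝ) + 1 / 2) ⊆ config lam}
  have hweight : Tendsto (fun N => ∑' lam, S.indicator (truncatedWeight ξ q N) lam) atTop
      (𝓝 (∑' lam, S.indicator (rawWeight ξ q) lam)) := by
    refine tendsto_tsum_of_dominated_convergence hsum (fun lam => ?_)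
      (Eventually.of_forall fun N lam => ?_)
    · by_cases hl : lam ∈ S
      · simpa only [Set.indicator_of_mem hl] using tendsto_truncatedWeight ξ hq hq1 lam
      · simpa only [Set.indicator_of_notMem hl] using tendsto_const_nhds
    · refine (norm_indicator_le_norm_self _ _).trans ?_
      rw [Real.norm_of_nonneg (truncatedWeight_nonneg ξ hq N lam)]
      exact truncatedWeight_le_rawWeight ξ hq hq1 N lam
  have hlarge : ∀ᶠ N : ℕ in atTop, ∀ i, 0 ≤ z i + N := eventually_all.2 fun i => by
    filter_upwards [eventually_ge_atTop (z i).natAbs] with N hN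
    omega
  have hdet := (tendsto_finiteMacMahon hq hq1 hξq).mul
    (tendsto_det_finiteKernel hξ hq hq1 hξq z)
  rw [tendsto_nhds_unique hdet (hweight.congr' (hlarge.mono fun N hN =>
    (hasSum_indicator_truncatedWeight hξ hq hq1 hξq hz hN).tsum_eq))]
  exact (hsum.indicator S).hasSum

theorem hasSum_rawWeight {ξ q : ℝ} (hξ : 0 < ξ) (hq : 0 < q) (hq1 : q < 1)
    (hξq : ξ ^ 2 * q < 1) : HasSum (rawWeight ξ q) (macMahon ξ q) := by
  have h := hasSum_indicator_rawWeight hξ hq hq1 hξq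
    (Function.injective_of_subsingleton Fin.elim0)
  simpa only [Set.range_eq_empty, Set.empty_subset, Set.ofPred_true, Set.indicator_univ,
    Matrix.det_isEmpty, mul_one] using h

/-! ### The squared type `q`-Plancherel measure -/

theorem macMahon_pos {ξ q : ℝ} (hξ : 0 < ξ) (hq : 0 < q) (hq1 : q < 1) (hξq : ξ ^ 2 * q < 1) :
    0 < macMahon ξ q := by
  refine lt_of_lt_of_le ?_ (le_hasSum (hasSum_rawWeight hξ hq hq1 hξq) ⊥
    fun lam _ => rawWeight_nonneg ξ hq lam)
  rw [rawWeight, YoungDiagram.cells_bot, Finset.prod_empty, mul_one]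
  positivity

theorem weight_eq_inv_macMahon_mul (ξ q : ℝ) :
    weight ξ q = fun lam => (macMahon ξ q)⁻¹ * rawWeight ξ q lam := by
  funext lam
  rw [weight, rawWeight]
  ring

theorem weight_nonneg {ξ q : ℝ} (hξ : 0 < ξ) (hq : 0 < q) (hq1 : q < 1) (hξq : ξ ^ 2 * q < 1)
    (lam : YoungDiagram) : 0 ≤ weight ξ q lam := by
  rw [weight_eq_inv_macMahon_mul]
  exact mul_nonneg (inv_pos.2 (macMahon_pos hξ hq hq1 hξq)).le (rawWeight_nonneg ξ hq lam)

theorem measureS_eq_of_hasSum {ξ q x : ℝ} (hw : ∀ lam, 0 ≤ weight ξ q lam)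
    {S : Set YoungDiagram} (h : HasSum (S.indicator (weight ξ q)) x) :
    measureS ξ q S = ENNReal.ofReal x := by
  have hS : MeasurableSet S := trivial
  rw [measureS, Measure.sum_apply _ hS, ← h.tsum_eq, ENNReal.ofReal_tsum_of_nonneg
    (Set.indicator_nonneg fun lam _ => hw lam) h.summable]
  refine tsum_congr fun lam => ?_
  rw [Measure.smul_apply, Measure.dirac_apply' _ hS]
  by_cases hl : lam ∈ S <;> simp [hl]

theorem isProbabilityMeasure_measureS {ξ q : ℝ} (hξ : 0 < ξ) (hq : 0 < q) (hq1 : q < 1)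
    (hξq : ξ ^ 2 * q < 1) : IsProbabilityMeasure (measureS ξ q) := by
  have h := (hasSum_rawWeight hξ hq hq1 hξq).mul_left (macMahon ξ q)⁻¹
  rw [inv_mul_cancel₀ (macMahon_pos hξ hq hq1 hξq).ne', ← weight_eq_inv_macMahon_mul,
    ← Set.indicator_univ (weight ξ q)] at h
  exact ⟨by rw [measureS_eq_of_hasSum (weight_nonneg hξ hq hq1 hξq) h, ENNReal.ofReal_one]⟩

theorem tendsto_kernelQuotient_qBesselKernel {ξ q : ℝ} (hξ : 0 < ξ) (hq : 0 < q) (hq1 : q < 1)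
    (hξq : ξ ^ 2 * q < 1) (r : ℝ) :
    Tendsto (fun u => kernelQuotient ξ q r u) (𝓝[≠] r) (𝓝 (qBesselKernel ξ q r r)) := by
  rw [qBesselKernel_eq_kernelSeries hξ hq hq1 hξq]
  exact tendsto_kernelQuotient hξ hq hq1 hξq r

theorem correlation_measureS {ξ q : ℝ} (hξ : 0 < ξ) (hq : 0 < q) (hq1 : q < 1)
    (hξq : ξ ^ 2 * q < 1) {k : ℕ} {z : Fin k → ℝ} (hz : ∀ i, z i ∈ halfIntegers)
    (hinj : Function.Injective z) :
    correlation (measureS ξ q) (Set.range z) =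
      Matrix.det (Matrix.of fun i j : Fin k => qBesselKernel ξ q (z i) (z j)) := by
  choose n hn using hz
  obtain rfl : z = fun i => (n i : ℝ) + 1 / 2 := funext hn
  have hninj : Function.Injective n := fun i j hij => hinj (by simp only [hij])
  have hw := weight_nonneg hξ hq hq1 hξq
  have h := (hasSum_indicator_rawWeight hξ hq hq1 hξq hninj).mul_left (macMahon ξ q)⁻¹
  rw [inv_mul_cancel_left₀ (macMahon_pos hξ hq hq1 hξq).ne'] at h
  simp only [← Set.indicator_const_mul, ← weight_eq_inv_macMahon_mul] at h
  rw [correlation, Measure.real, measureS_eq_of_hasSum hw h, ENNReal.toReal_ofReal]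
  exact h.nonneg (Set.indicator_nonneg fun lam _ => hw lam)

end QPlancherel

end

theorem theorem2_general (ξ q : ℝ) (hξ : 0 < ξ) (hq : 0 < q) (hq1 : q < 1) (hξq : ξ ^ 2 * q < 1) :
    IsProbabilityMeasure (QPlancherel.measureS ξ q) ∧
    (∀ r : ℝ, Tendsto (fun u : ℝ => QPlancherel.kernelQuotient ξ q r u) (𝓝[≠] r)
      (𝓝 (QPlancherel.qBesselKernel ξ q r r))) ∧
    (∀ (k : ℕ) (z : Fin k → ℝ), (∀ i, z i ∈ QPlancherel.halfIntegers) → Function.Injective z →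
      QPlancherel.correlation (QPlancherel.measureS ξ q) (Set.range z) =
        Matrix.det (Matrix.of fun i j : Fin k => QPlancherel.qBesselKernel ξ q (z i) (z j))) :=
  ⟨QPlancherel.isProbabilityMeasure_measureS hξ hq hq1 hξq,
    QPlancherel.tendsto_kernelQuotient_qBesselKernel hξ hq hq1 hξq,
    fun _ _ hz hinj => QPlancherel.correlation_measureS hξ hq hq1 hξq hz hinj⟩

theorem theorem2 (ξ q : ℝ) (hξ : 0 < ξ) (hξ1 : ξ < 1) (hq : 0 < q) (hq1 : q < 1) :
    -- the squared type `q`-Plancherel measure is a probability measure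
    IsProbabilityMeasure (QPlancherel.measureS ξ q) ∧
    -- the limits that give the diagonal values of the kernel exist
    (∀ r ∈ QPlancherel.halfIntegers,
      Tendsto (fun u : ℝ => QPlancherel.kernelQuotient ξ q r u) (𝓝[≠] r)
        (𝓝 (QPlancherel.qBesselKernel ξ q r r))) ∧
    -- all correlation functions are determinants of the `q`-Bessel kernel
    (∀ (k : ℕ) (z : Fin k → ℝ), (∀ i, z i ∈ QPlancherel.halfIntegers) → Function.Injective z →
      QPlancherel.correlation (QPlancherel.measureS ξ q) (Set.range z) =
        Matrix.det (Matrix.of fun i j : Fin k => QPlancherel.qBesselKernel ξ q (z i) (z j))) := by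
  have hξq : ξ ^ 2 * q < 1 :=
    mul_lt_one_of_nonneg_of_lt_one_left (sq_nonneg ξ) (pow_lt_one₀ hξ.le hξ1 two_ne_zero) hq1.le
  obtain ⟨hprob, hlim, hcorr⟩ := theorem2_general ξ q hξ hq hq1 hξq
  exact ⟨hprob, fun r _ => hlim r, hcorr⟩
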